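/- Let $r \ge 1$ and $n \ge 0$ be integers, $\omega = e^{2\pi i/r}$, $\mu_r = \langle\omega\rangle$, $[n]=\{1,\dots,n\}$, and let $\mathfrak S_n^{(r)} = \Delta_n^{(r)} \rtimes \mathfrak S_n$ be the group of monomial $n\times n$-matrices whose nonzero entries are $r$th roots of unity; here $\Delta_n^{(r)}\cong\mu_r^n$ is the group of diagonal matrices, generated by the matrices $t_j=\operatorname{diag}(1,\dots,1,\omega,1,\dots,1)$ with $\omega$ in position $j$. All modules are over $\mathbb C$; permutations act from the right and are multiplied from left to right. An $r$-partition $\lambda=(\lambda^{(0)},\dots,\lambda^{(r-1)})\vdash^r n$ is a sequence of $r$ partitions of sizes $n^{(k)}=|\lambda^{(k)}|$ with $\sum_k n^{(k)}=n$; its transpose $\lambda^t$ is formed componentwise. An $r$-word is a word $w=w_1\cdots w_n$ with letters $w_i=(a,\omega^k)\in[n]\times\mu_r$, of radius $a$ and phase $k \in \{0,\dots,r-1\}$. Let $w_\lambda$ be the canonical $r$-word of shape $\lambda$, which for $k=0,\dots,r-1$ in turn has $\lambda^{(k)}_1$ letters $(1,\omega^k)$, then $\lambda^{(k)}_2$ letters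 $(2,\omega^k)$, and so on, and let $X_\lambda$ be the set of its rearrangements. Let $V^\lambda$ be the $\mathfrak S_n^{(r)}$-module with basis $X_\lambda$ on which $\sigma\in\mathfrak S_n$ acts by $(x_1\cdots x_n).\sigma=x_{1.\sigma^{-1}}\cdots x_{n.\sigma^{-1}}$ and $x.t_j=\omega^k x$, where $k$ is the phase of $x_j$. For $x\in X_\lambda$ and $y\in X_{\lambda^t}$ put $m^\lambda_{yx}=0$ unless $x$ and $y$ have the same phase in every position and only the identity of $\mathfrak S_n$ fixes both $x$ and $y$. In that case let $T=(T^{(0)},\dots,T^{(r-1)})$ be the multitableau of shape $\lambda$ in which $T^{(k)}(a,b)$ is the unique position $i$ with $x_i=(a,\omega^k)$ and $y_i=(b,\omega^k)$, and let $m^\lambda_{yx}$ be the sign of the permutation of $[n]$ whose list of images is the concatenation of the rows of $T^{(0)},T^{(1)},\dots,T^{(r-1)}$. Put $v_y=\sum_{x\in X_\lambda}m^\lambda_{yx}\,x\in V^\lambda$ and let $S^\lambda$ be the span of the $v_y$, $y\in X_{\lambda^t}$; it is an $\mathfrak S_n^{(r)}$-submodule of $V^\lambda$. In the same way (without phases,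 that is, for $r=1$), each partition $\mu$ of $m$ gives an $\mathfrak S_m$-module $S^\mu$, whose character is denoted $\chi^\mu$. For $\lambda\vdash^r n$ define the character $$\chi^\lambda=\Bigl(\bigl(\overline\eta^{(0)}_{n^{(0)}}\otimes\tilde\chi^{\lambda^{(0)}}\bigr)\boxtimes\cdots\boxtimes\bigl(\overline\eta^{(r-1)}_{n^{(r-1)}}\otimes\tilde\chi^{\lambda^{(r-1)}}\bigr)\Bigr)^{\mathfrak S_n^{(r)}},$$ induced from the block diagonal subgroup $\mathfrak S^{(r)}_{n^{(0)}}\times\cdots\times\mathfrak S^{(r)}_{n^{(r-1)}}$, where $\overline\eta^{(k)}_m$ is the linear character of $\mathfrak S_m^{(r)}$ with $t_j\mapsto\omega^k$ for all $j$ and $\sigma\mapsto 1$ for $\sigma\in\mathfrak S_m$, and $\tilde\chi^\mu$ is the inflation of $\chi^\mu$ along $\mathfrak S_m^{(r)}\to\mathfrak S_m$. **Theorem.** For every $\lambda\vdash^r n$ the module $S^\lambda$ has character $\chi^\lambda$. The modules $S^\lambda$, $\lambda\vdash^r n$, form a complete set of pairwise non-isomorphic irreducible $\mathbb C\mathfrak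 S_n^{(r)}$-modules: each $S^\lambda$ is irreducible, $S^\lambda\cong S^{\lambda'}$ only if $\lambda=\lambda'$, and every irreducible $\mathbb C\mathfrak S_n^{(r)}$-module is isomorphic to some $S^\lambda$. -/

import Mathlib

open Equiv
open scoped MonoidAlgebra

noncomputable section

namespace MultiSpecht

/-! ### Words

Functions act from the right in the source, so that permutations are multiplied there in the order
opposite to Mathlib's and modules are right modules.  A right action `w.σ = σ⁻¹ w` is in Mathlib's
conventions the left action `σ • w = w ∘ σ⁻¹`; thus right modules over the groups of the source are
left modules over the groups used here. -/

/-- The words of length `n` that are rearrangements of the word (list) `l`. -/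
def Rearrangements {B : Type*} (n : ℕ) (l : List B) : Type _ :=
  {w : Fin n → B // (List.ofFn w).Perm l}

section Words

variable {n : ℕ} {B : Type*} {l : List B}

/-- The symmetric group acts by permuting the letters: the `i`-th letter of `σ • w` is the letter
of `w` at position `σ⁻¹ i`. -/
instance : MulAction (Perm (Fin n)) (Rearrangements n l) where
  smul σ w := ⟨fun i => w.1 (σ⁻¹ i), (Equiv.Perm.ofFn_comp_perm σ⁻¹ w.1).trans w.2⟩
  one_smul _ := rfl
  mul_smul _ _ _ := rfl

theorem smul_val (σ : Perm (Fin n)) (w : Rearrangements n l) (i : Fin n) :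
    (σ • w).1 i = w.1 (σ⁻¹ i) := rfl

instance [Fintype B] : Finite (Rearrangements n l) := Subtype.finite

instance [Fintype B] : Fintype (Rearrangements n l) := Fintype.ofFinite _

/-- The pair of words `(x, y)` has trivial stabilizer in the symmetric group. -/
def IsFreePair {B C : Type*} (x : Fin n → B) (y : Fin n → C) : Prop :=
  ∀ σ : Perm (Fin n), (fun i => x (σ⁻¹ i)) = x → (fun i => y (σ⁻¹ i)) = y → σ = 1

end Words

/-! ### The symmetric group -/

/-- The canonical word `1^{μ₁} 2^{μ₂} ⋯ n^{μₙ}` of a partition `μ` of `n`, over the alphabet `Fin n`.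
Partitions are represented by their Young diagrams. -/
def canonicalWord (n : ℕ) (μ : YoungDiagram) : List (Fin n) :=
  (List.finRange n).flatMap fun a : Fin n => List.replicate (μ.rowLen a) a

/-- The set `X_μ` of rearrangements of the canonical word of `μ`. -/
abbrev X (n : ℕ) (μ : YoungDiagram) : Type := Rearrangements n (canonicalWord n μ)

/-- The permutation module of the symmetric group with basis `X_μ`. -/
def symmetricRep (n : ℕ) (μ : YoungDiagram) : Representation ℂ (Perm (Fin n)) (X n μ →₀ ℂ) where
  toFun σ := Finsupp.lmapDomain ℂ ℂ (σ • ·)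
  map_one' := by
    refine Finsupp.lhom_ext fun x c => ?_
    simp [Finsupp.mapDomain_single]
  map_mul' σ τ := by
    refine Finsupp.lhom_ext fun x c => ?_
    simp [Finsupp.mapDomain_single, mul_smul]

theorem symmetricRep_single {n : ℕ} {μ : YoungDiagram} (σ : Perm (Fin n)) (x : X n μ) (c : ℂ) :
    symmetricRep n μ σ (Finsupp.single x c) = Finsupp.single (σ • x) c :=
  Finsupp.mapDomain_single

/-- The permutation obtained by concatenating the rows of the tableau of the pair `(x, y)`.  The
entry of the tableau in row `a` and column `b` is the position `i` with `x i = a` and `y i = b`, so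
reading the tableau row by row lists the positions `i` in lexicographic order of `(x i, y i)`. -/
def flat {n : ℕ} (x y : Fin n → Fin n) : Perm (Fin n) :=
  Tuple.sort fun i => toLex (x i, y i)

open Classical in
/-- The entry in row `y` and column `x` of the Specht matrix. -/
def spechtEntry {n : ℕ} (y x : Fin n → Fin n) : ℂ :=
  if IsFreePair x y then ((Perm.sign (flat x y) : ℤ) : ℂ) else 0

/-- The vector `v_y = ∑ₓ m_{yx} x` in the permutation module with basis `X_μ`. -/
def spechtVector (n : ℕ) (μ : YoungDiagram) (y : X n μ.transpose) : X n μ →₀ ℂ :=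
  ∑ x : X n μ, Finsupp.single x (spechtEntry y.1 x.1)

/-! ### Multipartitions and monomial groups -/

/-- An `r`-partition of `n`: a sequence of `r` partitions whose sizes sum to `n`. -/
@[ext]
structure MultiPartition (r n : ℕ) where
  part : Fin r → YoungDiagram
  sum_card : ∑ k, (part k).card = n

/-- The componentwise transpose of a multipartition. -/
def MultiPartition.transpose {r n : ℕ} (p : MultiPartition r n) : MultiPartition r n where
  part k := (p.part k).transpose
  sum_card := by
    refine Eq.trans (Finset.sum_congr rfl fun k _ => ?_) p.sum_card
    simp [YoungDiagram.transpose, YoungDiagram.card]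

/-- The group of `n × n` monomial matrices whose nonzero entries are `r`-th roots of unity, in the
form `μ_r^n ⋊ S_n`.  The element `(α, π)` is the product of `diag α` and the permutation matrix of
`π` sending the `i`-th standard basis vector to the `π i`-th one. -/
abbrev MonomialGroup (r n : ℕ) : Type :=
  (Fin n → rootsOfUnity r ℂ) ⋊[mulAutArrow] Perm (Fin n)

instance (r n : ℕ) [NeZero r] : Finite (MonomialGroup r n) :=
  Finite.of_equiv _ SemidirectProduct.equivProd.symm

instance (r n : ℕ) [NeZero r] : Fintype (MonomialGroup r n) := Fintype.ofFinite _

/-! ### Multiwords and the modules `V^λ` and `S^λ` -/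

/-- The canonical `r`-word of shape `p`.  A letter `(a, k)` has radius `a` and phase `k`; it stands
for the letter `(a, ω ^ k)`, where `ω = exp (2πi/r)`. -/
def canonicalMultiword {r n : ℕ} (p : MultiPartition r n) : List (Fin n × Fin r) :=
  (List.finRange r).flatMap fun k => (canonicalWord n (p.part k)).map fun a => (a, k)

/-- The set `X_λ` of rearrangements of the canonical `r`-word of shape `λ = p`. -/
abbrev MX {r n : ℕ} (p : MultiPartition r n) : Type := Rearrangements n (canonicalMultiword p)

/-- The scalar by which `diag α` acts on the line spanned by the word `w`: the matrix `t_j` with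
entry `ω` in position `j` acts by `ω ^ k`, where `k` is the phase of the `j`-th letter. -/
def weight {r n : ℕ} (α : Fin n → rootsOfUnity r ℂ) (w : Fin n → Fin n × Fin r) : ℂ :=
  ∏ i, ((α i : ℂˣ) : ℂ) ^ ((w i).2 : ℕ)

theorem weight_one {r n : ℕ} (w : Fin n → Fin n × Fin r) : weight 1 w = 1 := by
  simp [weight]

theorem weight_mul {r n : ℕ} (α β : Fin n → rootsOfUnity r ℂ) (w : Fin n → Fin n × Fin r) :
    weight (α * β) w = weight α w * weight β w := by
  simp [weight, mul_pow, Finset.prod_mul_distrib]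

theorem weight_smul {r n : ℕ} {l : List (Fin n × Fin r)} (σ : Perm (Fin n))
    (α : Fin n → rootsOfUnity r ℂ) (x : Rearrangements n l) :
    weight (mulAutArrow σ α) (σ • x).1 = weight α x.1 := by
  unfold weight
  rw [← Equiv.prod_comp σ]
  refine Finset.prod_congr rfl fun i _ => ?_
  have h : mulAutArrow σ α (σ i) = α i :=
    congrArg α (σ.symm_apply_apply i)
  have h' : σ⁻¹ (σ i) = i := σ.symm_apply_apply i
  rw [h, smul_val, h']

/-- The linear map by which `(α, π)` acts on the space with basis `X_λ`. -/
def monomialAct {r n : ℕ} (p : MultiPartition r n) (g : MonomialGroup r n) :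
    (MX p →₀ ℂ) →ₗ[ℂ] (MX p →₀ ℂ) :=
  Finsupp.linearCombination ℂ fun x : MX p =>
    Finsupp.single (g.right • x) (weight g.left (g.right • x).1)

theorem monomialAct_single {r n : ℕ} (p : MultiPartition r n) (g : MonomialGroup r n)
    (x : MX p) (c : ℂ) : monomialAct p g (Finsupp.single x c) =
      Finsupp.single (g.right • x) (c * weight g.left (g.right • x).1) := by
  simp [monomialAct]

/-- The module `V^λ` with basis `X_λ`: permutations permute the letters of the words in `X_λ`, and
diagonal matrices scale every word according to the phases of its letters. -/
def monomialRep {r n : ℕ} (p : MultiPartition r n) :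
    Representation ℂ (MonomialGroup r n) (MX p →₀ ℂ) where
  toFun := monomialAct p
  map_one' := by
    refine Finsupp.lhom_ext fun x c => ?_
    rw [monomialAct_single]
    simp [weight_one]
  map_mul' g h := by
    refine Finsupp.lhom_ext fun x c => ?_
    rw [Module.End.mul_apply, monomialAct_single, monomialAct_single, monomialAct_single]
    simp only [SemidirectProduct.mul_left, SemidirectProduct.mul_right, weight_mul, mul_smul,
      weight_smul]
    congr 1
    ring

/-- The permutation obtained by concatenating the rows of the tableaux `T^(0), …, T^(r-1)` of a
pair `(x, y)` of `r`-words with equal phases: it lists the positions `i` in lexicographic order of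
phase, row (radius of `x i`) and column (radius of `y i`). -/
def multiFlat {r n : ℕ} (x y : Fin n → Fin n × Fin r) : Perm (Fin n) :=
  Tuple.sort fun i => toLex ((x i).2, toLex ((x i).1, (y i).1))

open Classical in
/-- The entry in row `y` and column `x` of the Specht matrix: the sign of the multitableau if `x`
and `y` have the same phases in all positions and `(x, y)` has trivial stabilizer, and `0`
otherwise. -/
def multiSpechtEntry {r n : ℕ} (y x : Fin n → Fin n × Fin r) : ℂ :=
  if (∀ i, (x i).2 = (y i).2) ∧ IsFreePair x y then ((Perm.sign (multiFlat x y) : ℤ) : ℂ) else 0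

/-- The vector `v_y = ∑ₓ m_{yx} x` in `V^λ`, for `y` in `X_{λᵗ}`. -/
def multiSpechtVector {r n : ℕ} (p : MultiPartition r n) (y : MX p.transpose) : MX p →₀ ℂ :=
  ∑ x : MX p, Finsupp.single x (multiSpechtEntry y.1 x.1)

/-! ### The spans of the vectors `v_y` are subrepresentations -/

section Invariance

variable {n : ℕ}

theorem sort_comp_inv {L : Type*} [LinearOrder L] (key : Fin n → L)
    (hk : Function.Injective key) (σ : Perm (Fin n)) :
    Tuple.sort (fun i => key (σ⁻¹ i)) = σ * Tuple.sort key := by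
  have h1 : Monotone ((fun i => key (σ⁻¹ i)) ∘ (σ * Tuple.sort key : Perm (Fin n))) := by
    have := Tuple.monotone_sort key
    convert this using 1
    ext i
    simp
  have h2 := Tuple.unique_monotone (Tuple.monotone_sort fun i => key (σ⁻¹ i)) h1
  ext i
  have h3 := congrFun h2 i
  exact congrArg Fin.val (σ⁻¹.injective (hk h3))

theorem comp_swap_inv {B : Type*} (z : Fin n → B) {i j : Fin n} (hz : z i = z j) :
    (fun k => z ((Equiv.swap i j)⁻¹ k)) = z := by
  funext k
  rw [Equiv.swap_inv]
  by_cases hk : k = i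
  · subst hk; simp [hz]
  · by_cases hkj : k = j
    · subst hkj; simp [hz]
    · rw [Equiv.swap_apply_of_ne_of_ne hk hkj]

theorem IsFreePair.eq_of_eq {B C : Type*} {x : Fin n → B} {y : Fin n → C}
    (h : IsFreePair x y) {i j : Fin n} (hx : x i = x j) (hy : y i = y j) : i = j :=
  Equiv.swap_eq_one_iff.mp (h _ (comp_swap_inv x hx) (comp_swap_inv y hy))

theorem IsFreePair.comp_inv {B C : Type*} {x : Fin n → B} {y : Fin n → C}
    (h : IsFreePair x y) (σ : Perm (Fin n)) :
    IsFreePair (fun i => x (σ⁻¹ i)) (fun i => y (σ⁻¹ i)) := by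
  intro τ hx hy
  have h1 : σ⁻¹ * τ * σ = 1 := by
    apply h
    · funext i
      simpa using congrFun hx (σ i)
    · funext i
      simpa using congrFun hy (σ i)
  have h2 : τ = σ * (σ⁻¹ * τ * σ) * σ⁻¹ := by group
  rw [h2, h1]
  group

theorem isFreePair_comp_inv {B C : Type*} (x : Fin n → B) (y : Fin n → C) (σ : Perm (Fin n)) :
    IsFreePair (fun i => x (σ⁻¹ i)) (fun i => y (σ⁻¹ i)) ↔ IsFreePair x y :=
  ⟨fun h => by simpa using h.comp_inv σ⁻¹, fun h => h.comp_inv σ⟩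

theorem sign_mul_sign (σ τ : Perm (Fin n)) :
    ((Perm.sign σ : ℤ) : ℂ) * ((Perm.sign (σ * τ) : ℤ) : ℂ) = ((Perm.sign τ : ℤ) : ℂ) := by
  rw [Perm.sign_mul, Units.val_mul, Int.cast_mul, ← mul_assoc]
  rcases Int.units_eq_one_or (Perm.sign σ) with h | h <;> simp [h]

theorem spechtEntry_comp_inv (σ : Perm (Fin n)) (y x : Fin n → Fin n) :
    spechtEntry y x =
      ((Perm.sign σ : ℤ) : ℂ) * spechtEntry (fun i => y (σ⁻¹ i)) (fun i => x (σ⁻¹ i)) := by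
  unfold spechtEntry
  rw [isFreePair_comp_inv]
  by_cases h : IsFreePair x y
  · have hs : flat (fun i => x (σ⁻¹ i)) (fun i => y (σ⁻¹ i)) = σ * flat x y := by
      refine sort_comp_inv (fun i => toLex (x i, y i)) (fun i j hij => ?_) σ
      have := toLex.injective hij
      exact h.eq_of_eq (congrArg Prod.fst this) (congrArg Prod.snd this)
    rw [if_pos h, if_pos h, hs, sign_mul_sign]
  · simp [h]

theorem multiSpechtEntry_comp_inv {r : ℕ} (σ : Perm (Fin n)) (y x : Fin n → Fin n × Fin r) :
    multiSpechtEntry y x =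
      ((Perm.sign σ : ℤ) : ℂ) *
        multiSpechtEntry (fun i => y (σ⁻¹ i)) (fun i => x (σ⁻¹ i)) := by
  unfold multiSpechtEntry
  have hp : ((∀ i, (x (σ⁻¹ i)).2 = (y (σ⁻¹ i)).2) ∧
      IsFreePair (fun i => x (σ⁻¹ i)) (fun i => y (σ⁻¹ i))) ↔
      (∀ i, (x i).2 = (y i).2) ∧ IsFreePair x y := by
    rw [isFreePair_comp_inv]
    exact and_congr_left fun _ => ⟨fun h i => by simpa using h (σ i), fun h i => h _⟩
  by_cases h : (∀ i, (x i).2 = (y i).2) ∧ IsFreePair x y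
  · have hs : multiFlat (fun i => x (σ⁻¹ i)) (fun i => y (σ⁻¹ i)) = σ * multiFlat x y := by
      refine sort_comp_inv (fun i => toLex ((x i).2, toLex ((x i).1, (y i).1)))
        (fun i j hij => ?_) σ
      have h0 := toLex.injective hij
      have h1 := congrArg Prod.fst h0
      have h2 := toLex.injective (congrArg Prod.snd h0)
      have h3 := congrArg Prod.fst h2
      have h4 := congrArg Prod.snd h2
      dsimp only at h1 h3 h4
      exact h.2.eq_of_eq (Prod.ext h3 h1)
        (Prod.ext h4 ((h.1 i).symm.trans (h1.trans (h.1 j))))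
    rw [if_pos h, if_pos (hp.mpr h), hs, sign_mul_sign]
  · rw [if_neg h, if_neg (mt hp.mp h), mul_zero]

theorem symmetricRep_spechtVector (μ : YoungDiagram) (σ : Perm (Fin n)) (y : X n μ.transpose) :
    symmetricRep n μ σ (spechtVector n μ y) =
      ((Perm.sign σ : ℤ) : ℂ) • spechtVector n μ (σ • y) := by
  unfold spechtVector
  rw [map_sum, Finset.smul_sum]
  refine Eq.trans (Finset.sum_congr rfl fun x _ => ?_) (Equiv.sum_comp (MulAction.toPerm σ) _)
  rw [symmetricRep_single, Finsupp.smul_single, smul_eq_mul, spechtEntry_comp_inv σ]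
  rfl

theorem monomialRep_multiSpechtVector {r : ℕ} (p : MultiPartition r n) (g : MonomialGroup r n)
    (y : MX p.transpose) : monomialRep p g (multiSpechtVector p y) =
      (((Perm.sign g.right : ℤ) : ℂ) * weight g.left (g.right • y).1) •
        multiSpechtVector p (g.right • y) := by
  unfold multiSpechtVector
  rw [map_sum, Finset.smul_sum]
  refine Eq.trans (Finset.sum_congr rfl fun x _ => ?_)
    (Equiv.sum_comp (MulAction.toPerm g.right) _)
  have h := monomialAct_single p g x (multiSpechtEntry y.1 x.1)
  change monomialAct p g _ = _
  rw [h, Finsupp.smul_single, smul_eq_mul, multiSpechtEntry_comp_inv g.right]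
  change Finsupp.single (g.right • x) (_ * multiSpechtEntry (g.right • y).1 (g.right • x).1 * _) =
    Finsupp.single (g.right • x) (_ * multiSpechtEntry (g.right • y).1 (g.right • x).1)
  congr 1
  by_cases hp : ∀ i, ((g.right • x).1 i).2 = ((g.right • y).1 i).2
  · have hw : weight g.left (g.right • x).1 = weight g.left (g.right • y).1 :=
      Finset.prod_congr rfl fun i _ => by rw [hp i]
    rw [hw]
    ring
  · simp [multiSpechtEntry, hp]

end Invariance

/-- The Specht module `S^μ` of the symmetric group: the span of the vectors `v_y`, for `y` in
`X_{μᵗ}`, in the permutation module with basis `X_μ`. -/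
def symmetricSpecht (n : ℕ) (μ : YoungDiagram) :
    Subrepresentation (symmetricRep n μ) where
  toSubmodule := Submodule.span ℂ (Set.range (spechtVector n μ))
  apply_mem_toSubmodule σ v hv := by
    induction hv using Submodule.span_induction with
    | mem v hv =>
      obtain ⟨y, rfl⟩ := hv
      rw [symmetricRep_spechtVector]
      exact Submodule.smul_mem _ _ (Submodule.subset_span ⟨_, rfl⟩)
    | zero => simp
    | add v w _ _ hv hw => rw [map_add]; exact add_mem hv hw
    | smul c v _ hv => rw [map_smul]; exact Submodule.smul_mem _ _ hv

/-- The module `S^λ` of the monomial group: the span of the vectors `v_y`, for `y` in `X_{λᵗ}`,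
in `V^λ`. -/
def multiSpecht {r n : ℕ} (p : MultiPartition r n) : Subrepresentation (monomialRep p) where
  toSubmodule := Submodule.span ℂ (Set.range (multiSpechtVector p))
  apply_mem_toSubmodule g v hv := by
    induction hv using Submodule.span_induction with
    | mem v hv =>
      obtain ⟨y, rfl⟩ := hv
      rw [monomialRep_multiSpechtVector]
      exact Submodule.smul_mem _ _ (Submodule.subset_span ⟨_, rfl⟩)
    | zero => simp
    | add v w _ _ hv hw => rw [map_add]; exact add_mem hv hw
    | smul c v _ hv => rw [map_smul]; exact Submodule.smul_mem _ _ hv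

/-- The underlying vector space of `S^μ`. -/
def SymmetricSpace (n : ℕ) (μ : YoungDiagram) : Type := (symmetricSpecht n μ).toSubmodule

instance (n : ℕ) (μ : YoungDiagram) : AddCommGroup (SymmetricSpace n μ) :=
  inferInstanceAs (AddCommGroup (symmetricSpecht n μ).toSubmodule)

instance (n : ℕ) (μ : YoungDiagram) : Module ℂ (SymmetricSpace n μ) :=
  inferInstanceAs (Module ℂ (symmetricSpecht n μ).toSubmodule)

/-- The action of the symmetric group on `S^μ`. -/
def symmetricSpechtRep (n : ℕ) (μ : YoungDiagram) :
    Representation ℂ (Perm (Fin n)) (SymmetricSpace n μ) :=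
  (symmetricSpecht n μ).toRepresentation

/-- The underlying vector space of `S^λ`. -/
def MultiSpace {r n : ℕ} (p : MultiPartition r n) : Type := (multiSpecht p).toSubmodule

instance {r n : ℕ} (p : MultiPartition r n) : AddCommGroup (MultiSpace p) :=
  inferInstanceAs (AddCommGroup (multiSpecht p).toSubmodule)

instance {r n : ℕ} (p : MultiPartition r n) : Module ℂ (MultiSpace p) :=
  inferInstanceAs (Module ℂ (multiSpecht p).toSubmodule)

/-- The action of the monomial group on `S^λ`. -/
def multiSpechtRep {r n : ℕ} (p : MultiPartition r n) :
    Representation ℂ (MonomialGroup r n) (MultiSpace p) :=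
  (multiSpecht p).toRepresentation

/-! ### The characters `χ^λ` -/

/-- The character `χ^μ` of the Specht module `S^μ` of the symmetric group of degree `|μ|`. -/
def symmetricChar (μ : YoungDiagram) : Perm (Fin μ.card) → ℂ :=
  (symmetricSpechtRep μ.card μ).character

/-- The linear character of the monomial group with `t_j ↦ ω ^ k` for all `j`, which is trivial on
permutations. -/
def linearChar {r n : ℕ} (k : Fin r) (g : MonomialGroup r n) : ℂ :=
  ∏ i, ((g.left i : ℂˣ) : ℂ) ^ (k : ℕ)

/-- The decomposition of `{0, …, n-1}` into consecutive intervals of lengths `m 0, …, m (r-1)`. -/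
def blocks {r n : ℕ} (m : Fin r → ℕ) (h : ∑ k, m k = n) : ((k : Fin r) × Fin (m k)) ≃ Fin n :=
  finSigmaFinEquiv.trans (finCongr h)

/-- The block diagonal embedding of a direct product of monomial groups of degrees
`m 0, …, m (r-1)` into the monomial group of degree `n = ∑ k, m k`. -/
def blockEmbedding {r n : ℕ} (m : Fin r → ℕ) (h : ∑ k, m k = n) :
    (∀ k, MonomialGroup r (m k)) →* MonomialGroup r n where
  toFun g :=
    ⟨fun i => (g ((blocks m h).symm i).1).left ((blocks m h).symm i).2,
      (blocks m h).permCongr (Perm.sigmaCongrRight fun k => (g k).right)⟩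
  map_one' := by
    refine SemidirectProduct.ext rfl (Equiv.ext fun i => ?_)
    simp [Equiv.permCongr_apply]
  map_mul' g g' := by
    refine SemidirectProduct.ext (funext fun i => ?_) (Equiv.ext fun i => ?_)
    · rw [SemidirectProduct.mul_left, Pi.mul_apply]
      refine congrArg ((g ((blocks m h).symm i).1).left ((blocks m h).symm i).2 * ·) ?_
      obtain ⟨⟨k, j⟩, rfl⟩ := (blocks m h).surjective i
      change mulAutArrow (g ((blocks m h).symm (blocks m h ⟨k, j⟩)).1).right _ _ =
        (g' ((blocks m h).symm (blocks m h ((Perm.sigmaCongrRight fun k => (g k).right).symm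
          ((blocks m h).symm (blocks m h ⟨k, j⟩))))).1).left
          ((blocks m h).symm (blocks m h ((Perm.sigmaCongrRight fun k => (g k).right).symm
          ((blocks m h).symm (blocks m h ⟨k, j⟩))))).2
      rw [symm_apply_apply, symm_apply_apply]
      rfl
    · simp [Equiv.permCongr_apply]

/-- The class function (character) of `G` induced from a class function (character) `ψ` of a
subgroup `H`, embedded into `G` by `ι`. -/
def inducedChar {G H : Type*} [Group G] [Group H] [Fintype G] [Fintype H]
    (ι : H →* G) (ψ : H → ℂ) (g : G) : ℂ :=
  open Classical in
  (Fintype.card H : ℂ)⁻¹ * ∑ s : G, ∑ h : H, if ι h = s⁻¹ * g * s then ψ h else 0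

/-- The character `χ^λ`.  With `n_k = |λ^(k)|`, tensor the linear character `t_j ↦ ω ^ k` of the
monomial group of degree `n_k` with the inflation of the character `χ^{λ^(k)}` of `S_{n_k}`, take
the outer tensor product over all `k`, and induce to the monomial group of degree `n`. -/
def cliffordChar {r n : ℕ} [NeZero r] (p : MultiPartition r n) : MonomialGroup r n → ℂ :=
  inducedChar (blockEmbedding (fun k => (p.part k).card) p.sum_card)
    fun h => ∏ k, linearChar k (h k) * symmetricChar (p.part k) (h k).right

end MultiSpecht

end

/-!
The argument is a version of James' submodule theorem that treats the symmetric and the monomial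
groups alike.

*Irreducibility.* The stabilizer of a word `y` acts on the vector `v_y` by a linear character `θ`.
A word `x` that has other phases than `y`, or whose common stabilizer with `y` contains a
transposition, is separated from `y` by the stabilizer (`exists_separating`), so a vector that
transforms by `θ` is supported on words forming free pairs with `y`. A free pair of words of shapes
`μ` and `μᵗ` is a zero-one matrix with the row and column sums of `μ`, and the only such matrix is
the diagram of `μ` (`mem_diagram`); hence the words forming free pairs with `y` are a single orbit
of its stabilizer, and the `θ`-isotypic vectors are the multiples of `v_y`. Projecting a submodule
of `S^λ` to these isotypic parts shows that it contains some `v_y` or is orthogonal to all of them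
(`irreducible_of_span`).

*Distinctness.* An isomorphism `S^p ≅ S^q` maps `v_y` to a nonzero `θ`-isotypic vector of `V^q`, so
there is a free pair of shapes `q` and `pᵗ`, and each component of `p` dominates that of `q`
(`card_cells_le_of_equiv`). By symmetry `p = q`.

*Characters.* By Schur's lemma an irreducible character is determined by any one matrix coefficient
`f g = ℓ (g v)` with `ℓ v ≠ 0`, by an explicit formula (`character_eq_coeffChar`). That formula is
compatible with products, with twists by linear characters, and with extension by zero from a
subgroup, which becomes induction. For words `x` and `y` whose phases are constant on consecutive
blocks, the coefficient of `x` in `g • v_y` vanishes off the block diagonal subgroup and on it is a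
product of twisted coefficients of Specht modules of symmetric groups
(`multiSpechtCoeff_blockEmbedding`). So the character of `S^λ` is `χ^λ`, and no decomposition into
tensor products is needed.

*Completeness.* The conjugacy class of a monomial matrix is determined by the lengths of its cycles
with given product (`isConj_of_classData_eq`), so there are at most as many classes as
multipartitions. As irreducible characters are linearly independent class functions, the `S^λ`
leave no room for another irreducible module.
-/

noncomputable section

open scoped Finset

namespace MultiSpecht

/-! ### Characters from a single matrix coefficient -/

/-- The class function obtained from `f` by averaging over conjugates, normalized so that it is the
character of an irreducible representation whenever `f` is a matrix coefficient `g ↦ ℓ (g v)` of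
that representation with `ℓ v ≠ 0`. -/
def coeffChar {G : Type*} [Group G] [Fintype G] (f : G → ℂ) (g : G) : ℂ :=
  f 1 / (∑ h, f h * f h⁻¹) * ∑ s, f (s⁻¹ * g * s)

section CoeffChar

variable {G H : Type*} [Group G] [Group H] [Fintype G] [Fintype H]

/-- By Schur's lemma, averaging the rank one operator `v ⊗ ℓ` over the group gives a scalar `c`; the
traces of this operator and of its products with group elements, and its value at `v`, determine
both `c` and the character. -/
theorem character_eq_coeffChar {V : Type*} [AddCommGroup V] [Module ℂ V] [FiniteDimensional ℂ V]
    (ρ : Representation ℂ G V) [ρ.IsIrreducible] (v : V) (l : V →ₗ[ℂ] ℂ) (hl : l v ≠ 0) :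
    ρ.character = coeffChar fun g => l (ρ g v) := by
  let A : V →ₗ[ℂ] V := ∑ s : G, ρ s ∘ₗ l.smulRight v ∘ₗ ρ s⁻¹
  have hA : ∀ u, A u = ∑ s : G, l (ρ s⁻¹ u) • ρ s v := fun u => by
    simp [A, LinearMap.sum_apply]
  have hcomm : ∀ g u, A (ρ g u) = ρ g (A u) := fun g u => by
    rw [hA, hA, map_sum, ← Equiv.sum_comp (Equiv.mulLeft g)]
    refine Finset.sum_congr rfl fun s _ => ?_
    simp [← Module.End.mul_apply, ← map_mul]
  obtain ⟨c, hc⟩ :=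
    (Representation.IsIrreducible.algebraMap_intertwiningMap_bijective_of_isAlgClosed
      (ρ := ρ)).2 ⟨A, fun g => by ext u; exact hcomm g u⟩
  have hc' : ∀ u, A u = c • u := fun u => by
    have := congrArg (fun f : Representation.IntertwiningMap ρ ρ => f u) hc
    simpa using this.symm
  have hAc : A = c • LinearMap.id := LinearMap.ext hc'
  have htr : ∀ g, c * ρ.character g = ∑ s, l (ρ (s⁻¹ * g * s) v) := fun g => by
    have h1 : LinearMap.trace ℂ V (A ∘ₗ ρ g) = c * ρ.character g := by
      rw [hAc, LinearMap.smul_comp, LinearMap.id_comp, map_smul, smul_eq_mul]; rfl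
    rw [← h1]
    have h0 : A ∘ₗ ρ g = ∑ s : G, (ρ s ∘ₗ l.smulRight v ∘ₗ ρ s⁻¹) ∘ₗ ρ g := by
      ext u; simp [A, LinearMap.sum_apply]
    rw [h0, map_sum]
    refine Finset.sum_congr rfl fun s _ => ?_
    have h2 : (ρ s ∘ₗ l.smulRight v ∘ₗ ρ s⁻¹) ∘ₗ ρ g = ρ s ∘ₗ ((l ∘ₗ ρ (s⁻¹ * g)).smulRight v) := by
      ext u; simp
    have h3 : (l.comp (ρ (s⁻¹ * g))).smulRight v ∘ₗ ρ s = (l ∘ₗ ρ (s⁻¹ * g * s)).smulRight v := by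
      ext u; simp
    rw [h2, LinearMap.trace_comp_comm', h3, LinearMap.trace_smulRight]
    rfl
  have hcl : c * l v = ∑ s, l (ρ s v) * l (ρ s⁻¹ v) := by
    have := congrArg l (hc' v)
    rw [hA, map_sum, map_smul, smul_eq_mul] at this
    rw [← this]
    refine Finset.sum_congr rfl fun s _ => ?_
    rw [map_smul, smul_eq_mul, mul_comm]
  have hc0 : c ≠ 0 := by
    rintro rfl
    have := htr 1
    simp [hl] at this
  funext g
  have h1 : l (ρ 1 v) = l v := by simp
  rw [coeffChar, ← htr, ← hcl, h1]
  field_simp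

theorem coeffChar_pi {ι : Type*} [Fintype ι] [DecidableEq ι] {K : ι → Type*} [∀ k, Group (K k)]
    [∀ k, Fintype (K k)] [Fintype (∀ k, K k)] (F : ∀ k, K k → ℂ) (g : ∀ k, K k) :
    coeffChar (fun g : ∀ k, K k => ∏ k, F k (g k)) g = ∏ k, coeffChar (F k) (g k) := by
  have key : ∀ Φ : ∀ k, K k → ℂ, ∑ s : ∀ k, K k, ∏ k, Φ k (s k) = ∏ k, ∑ s, Φ k s := fun Φ => by
    rw [Finset.prod_univ_sum, Fintype.piFinset_univ]
    exact Finset.sum_congr (by ext; simp) fun _ _ => rfl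
  simp only [coeffChar, Finset.prod_mul_distrib, Finset.prod_div_distrib, ← key]
  rfl

/-- Multiplying an inflated coefficient by a linear character does the same to the class function.
The inflation is along `π`, all of whose fibres have `c` elements. -/
theorem coeffChar_mul_inflation (π : G →* H) (c : ℂ) (hc : c ≠ 0)
    (hπ : ∀ φ : H → ℂ, ∑ g, φ (π g) = c * ∑ h, φ h) (χ : G →* ℂ) (f : H → ℂ) (g : G) :
    coeffChar (fun g => χ g * f (π g)) g = χ g * coeffChar f (π g) := by
  have h1 : ∀ s, χ s * χ s⁻¹ = 1 := fun s => by rw [← map_mul, mul_inv_cancel, map_one]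
  have h2 : ∑ s, (χ s * f (π s)) * (χ s⁻¹ * f (π s⁻¹)) = c * ∑ h, f h * f h⁻¹ := by
    rw [← hπ]
    refine Finset.sum_congr rfl fun s _ => ?_
    rw [map_inv π]
    linear_combination (f (π s) * f (π s)⁻¹) * h1 s
  have h3 : ∑ s, χ (s⁻¹ * g * s) * f (π (s⁻¹ * g * s)) =
      χ g * (c * ∑ h, f (h⁻¹ * π g * h)) := by
    rw [← hπ fun h => f (h⁻¹ * π g * h), Finset.mul_sum]
    refine Finset.sum_congr rfl fun s _ => ?_
    simp only [map_mul, map_inv π]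
    linear_combination (χ g * f ((π s)⁻¹ * π g * π s)) * h1 s
  rw [coeffChar, h2, h3, coeffChar, map_one, map_one, one_mul]
  field_simp

/-- If a coefficient is supported on a subgroup, its class function is induced from there. -/
theorem coeffChar_eq_inducedChar (ι : H →* G) (hι : Function.Injective ι) (f : G → ℂ)
    (hf : ∀ g, f g ≠ 0 → g ∈ Set.range ι) :
    coeffChar f = inducedChar ι (coeffChar (f ∘ ι)) := by
  classical
  have hsum : ∀ φ : G → ℂ, (∀ g, φ g ≠ 0 → g ∈ Set.range ι) → ∑ g, φ g = ∑ h, φ (ι h) :=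
    fun φ hφ => (Finset.sum_of_injOn ι hι.injOn (by simp)
      (fun g _ hg => by
        by_contra h0
        obtain ⟨h, rfl⟩ := hφ g h0
        exact hg ⟨h, by simp, rfl⟩) (fun _ _ => rfl)).symm
  have hN : ∑ g, f g * f g⁻¹ = ∑ h, f (ι h) * f (ι h⁻¹) := by
    rw [hsum _ fun g hg => hf g (left_ne_zero_of_mul hg)]
    simp
  funext g
  have hpt : ∀ g, (∑ h, if ι h = g then f (ι h) else 0) = f g := fun g => by
    by_cases h0 : f g = 0
    · rw [h0]
      refine Finset.sum_eq_zero fun h _ => ?_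
      split_ifs with h1
      · rw [h1, h0]
      · rfl
    · obtain ⟨h, rfl⟩ := hf g h0
      simp [hι.eq_iff]
  have hswap : ∑ s : G, ∑ h : H, (if ι h = s⁻¹ * g * s then ∑ t : H, f (ι (t⁻¹ * h * t)) else 0) =
      Fintype.card H * ∑ s, f (s⁻¹ * g * s) := by
    calc _ = ∑ t : H, ∑ s : G, ∑ h : H, (if ι h = s⁻¹ * g * s then f (ι (t⁻¹ * h * t)) else 0) := by
          refine Eq.trans (Finset.sum_congr rfl fun s _ => ?_) Finset.sum_comm
          refine Eq.trans (Finset.sum_congr rfl fun h _ => ?_) Finset.sum_comm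
          split_ifs <;> simp
      _ = ∑ t : H, ∑ s, f (s⁻¹ * g * s) := by
          refine Finset.sum_congr rfl fun t _ => ?_
          rw [← Equiv.sum_comp (Equiv.mulRight (ι t)⁻¹)]
          refine Finset.sum_congr rfl fun s _ => ?_
          rw [← hpt (s⁻¹ * g * s), ← Equiv.sum_comp (MulAut.conj t).toEquiv]
          refine Finset.sum_congr rfl fun h _ => ?_
          have e1 : t⁻¹ * (MulAut.conj t h) * t = h := by simp [mul_assoc]
          have e2 : ι (MulAut.conj t h) =
              (s * (ι t)⁻¹)⁻¹ * g * (s * (ι t)⁻¹) ↔ ι h = s⁻¹ * g * s := by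
            have : (s * (ι t)⁻¹)⁻¹ * g * (s * (ι t)⁻¹) = ι t * (s⁻¹ * g * s) * (ι t)⁻¹ := by group
            rw [this]
            simp
          change (if ι (MulAut.conj t h) = (s * (ι t)⁻¹)⁻¹ * g * (s * (ι t)⁻¹) then
            f (ι (t⁻¹ * (MulAut.conj t h) * t)) else 0) = _
          rw [e1]
          simp only [e2]
      _ = _ := by simp
  have hH : (Fintype.card H : ℂ) ≠ 0 := by simp
  have hcase : inducedChar ι (coeffChar (f ∘ ι)) g = (Fintype.card H : ℂ)⁻¹ *
      (f 1 / (∑ h, f (ι h) * f (ι h⁻¹)) *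
      ∑ s : G, ∑ h : H, (if ι h = s⁻¹ * g * s then ∑ t : H, f (ι (t⁻¹ * h * t)) else 0)) := by
    unfold inducedChar coeffChar
    simp only [Finset.mul_sum, Function.comp_apply, map_one, mul_ite, mul_zero]
  rw [hcase, hswap, coeffChar, hN]
  field_simp

end CoeffChar

/-! ### A criterion for irreducibility -/

section Irreducible

variable {G : Type*} [Group G] [Finite G] {V : Type*} [AddCommGroup V] [Module ℂ V]

/-- Averaging against a linear character `θ` of a subgroup maps every vector to a vector that
transforms by `θ`, and multiplies by the order of the subgroup every functional that does so. -/
theorem exists_average (ρ : Representation ℂ G V) (H : Subgroup G) (θ : H →* ℂ) :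
    ∃ E : V →ₗ[ℂ] V, (∀ U : Subrepresentation ρ, ∀ u ∈ U, E u ∈ U) ∧
      (∀ u, ∀ g : H, ρ g (E u) = θ g • E u) ∧
      ∀ l : V →ₗ[ℂ] ℂ, (∀ (g : H) u, l (ρ g u) = θ g * l u) →
        ∀ u, l (E u) = Nat.card H * l u := by
  have := Fintype.ofFinite H
  have hE : ∀ u, (∑ g : H, θ g⁻¹ • ρ g) u = ∑ g : H, θ g⁻¹ • ρ g u := fun u => by
    simp [LinearMap.sum_apply]
  refine ⟨∑ g : H, θ g⁻¹ • ρ g, fun U u hu => ?_, fun u g => ?_, fun l hl u => ?_⟩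
  · rw [hE]
    exact U.toSubmodule.sum_mem fun g _ =>
      U.toSubmodule.smul_mem _ (U.apply_mem_toSubmodule _ hu)
  · rw [hE, map_sum, Finset.smul_sum, ← Equiv.sum_comp (Equiv.mulLeft g⁻¹)]
    refine Finset.sum_congr rfl fun h _ => ?_
    rw [map_smul, smul_smul, ← map_mul, ← Module.End.mul_apply, ← map_mul]
    simp [mul_comm]
  · rw [hE, map_sum, Nat.card_eq_fintype_card]
    rw [Finset.sum_congr rfl fun g _ => ?_, Finset.sum_const, Finset.card_univ, nsmul_eq_mul]
    rw [map_smul, hl, smul_eq_mul, ← mul_assoc, ← map_mul, inv_mul_cancel, map_one, one_mul]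

/-- A criterion in the spirit of James' submodule theorem.  If a submodule contained in `S` is not
annihilated by the averaging operators, it contains some `v y` and hence is all of `S`; otherwise it
is orthogonal to all `v y`, and hence to itself, since the `v y` have real coefficients. -/
theorem irreducible_of_span {X Y : Type*} [Fintype X] {ρ : Representation ℂ G (X →₀ ℂ)}
    (S : Subrepresentation ρ) (v : Y → X →₀ ℂ) (hS : S.toSubmodule = Submodule.span ℂ (Set.range v))
    (hreal : ∀ y x, (starRingEnd ℂ) (v y x) = v y x)
    (horb : ∀ y y', ∃ (g : G) (c : ℂ), v y' = c • ρ g (v y)) (hne : ∃ y, v y ≠ 0)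
    (H : Y → Subgroup G) (θ : ∀ y, H y →* ℂ)
    (huniq : ∀ y u, (∀ g : H y, ρ g u = θ y g • u) → ∃ c : ℂ, u = c • v y)
    (hdual : ∀ y (g : H y) u, ∑ x, v y x * ρ g u x = θ y g * ∑ x, v y x * u x) :
    IsSimpleOrder (Subrepresentation S.toRepresentation) := by
  have hv : ∀ y, v y ∈ S.toSubmodule := fun y => hS ▸ Submodule.subset_span ⟨y, rfl⟩
  have main : ∀ U : Subrepresentation ρ, U ≤ S → U ≠ ⊥ → S ≤ U := by
    intro U hUS hU
    obtain ⟨u, huU, hu0⟩ : ∃ u ∈ U.toSubmodule, u ≠ 0 := by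
      by_contra! h
      exact hU (Subrepresentation.toSubmodule_injective ((Submodule.eq_bot_iff _).2 h))
    have huS : u ∈ Submodule.span ℂ (Set.range v) := hS ▸ hUS huU
    obtain ⟨y, hy⟩ : ∃ y, ∑ x, v y x * u x ≠ 0 := by
      by_contra! h
      have h2 : ∀ w ∈ Submodule.span ℂ (Set.range v),
          ∑ x, (starRingEnd ℂ) (w x) * u x = 0 := by
        intro w hw
        induction hw using Submodule.span_induction with
        | mem w hw => obtain ⟨y, rfl⟩ := hw; simpa only [hreal] using h y
        | zero => simp
        | add a b _ _ ha hb => simp [add_mul, Finset.sum_add_distrib, ha, hb]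
        | smul c a _ ha => simp [mul_assoc, ← Finset.mul_sum, ha]
      have h3 := h2 u huS
      apply hu0
      ext x
      have h4 : ∑ x, Complex.normSq (u x) = 0 := by
        have : ((∑ x, Complex.normSq (u x) : ℝ) : ℂ) = 0 := by
          push_cast
          rw [← h3]
          exact Finset.sum_congr rfl fun x _ => Complex.normSq_eq_conj_mul_self
        exact_mod_cast this
      have := (Finset.sum_eq_zero_iff_of_nonneg fun x _ => Complex.normSq_nonneg (u x)).1 h4 x
        (Finset.mem_univ x)
      simpa using this
    obtain ⟨E, hE1, hE2, hE3⟩ := exists_average ρ (H y) (θ y)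
    let l : (X →₀ ℂ) →ₗ[ℂ] ℂ := ∑ x, v y x • Finsupp.lapply x
    have hl : ∀ w, l w = ∑ x, v y x * w x := fun w => by simp [l, LinearMap.sum_apply]
    obtain ⟨c, hc⟩ := huniq y (E u) (hE2 u)
    have hEu : E u ≠ 0 := by
      intro h0
      have := hE3 l (fun g w => by rw [hl, hl, hdual]) u
      rw [h0, map_zero, hl] at this
      have hcard : (Nat.card (H y) : ℂ) ≠ 0 := by
        exact_mod_cast Nat.card_pos.ne'
      exact mul_ne_zero hcard hy this.symm
    have hc0 : c ≠ 0 := by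
      rintro rfl
      exact hEu (by rw [hc, zero_smul])
    have hvy : v y ∈ U.toSubmodule := by
      have : v y = c⁻¹ • E u := by rw [hc, smul_smul, inv_mul_cancel₀ hc0, one_smul]
      rw [this]
      exact U.toSubmodule.smul_mem _ (hE1 U u huU)
    change S.toSubmodule ≤ U.toSubmodule
    rw [hS, Submodule.span_le]
    rintro _ ⟨y', rfl⟩
    obtain ⟨g, d, hd⟩ := horb y y'
    rw [hd]
    exact U.toSubmodule.smul_mem _ (U.apply_mem_toSubmodule g hvy)
  obtain ⟨y0, hy0⟩ := hne
  have hnt : Nontrivial (Subrepresentation S.toRepresentation) := by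
    refine ⟨⊥, ⊤, fun h => hy0 ?_⟩
    have : (⟨v y0, hv y0⟩ : S.toSubmodule) ∈
        (⊥ : Subrepresentation S.toRepresentation).toSubmodule :=
      h ▸ (trivial : (⟨v y0, hv y0⟩ : S.toSubmodule) ∈ (⊤ : Submodule ℂ S.toSubmodule))
    exact congrArg Subtype.val ((Submodule.mem_bot ℂ).1 this)
  refine { hnt with eq_bot_or_eq_top := fun U => ?_ }
  let U' : Subrepresentation ρ :=
    { toSubmodule := U.toSubmodule.map S.toSubmodule.subtype
      apply_mem_toSubmodule := by
        rintro g _ ⟨u, hu, rfl⟩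
        exact ⟨_, U.apply_mem_toSubmodule g hu, rfl⟩ }
  by_cases hU : U' = ⊥
  · left
    apply Subrepresentation.toSubmodule_injective
    refine (Submodule.eq_bot_iff _).2 fun u hu => Subtype.ext ?_
    have : (u : X →₀ ℂ) ∈ (⊥ : Subrepresentation ρ).toSubmodule := hU ▸ ⟨u, hu, rfl⟩
    exact (Submodule.mem_bot ℂ).1 this
  · right
    have hle : S ≤ U' := main U' (by rintro _ ⟨u, _, rfl⟩; exact u.2) hU
    apply Subrepresentation.toSubmodule_injective
    refine eq_top_iff.2 ?_
    rintro ⟨u, hu⟩ -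
    obtain ⟨u', hu', h⟩ := hle hu
    rwa [show u' = ⟨u, hu⟩ from Subtype.ext h] at hu'

end Irreducible

/-! ### Fillings of Young diagrams -/

section Fillings

variable {ι : Type*} [Fintype ι]

/-- Functions with fibres of equal sizes differ by a permutation of their domain. -/
theorem exists_perm_of_card_fiber_eq {A : Type*} [DecidableEq A] (f f' : ι → A)
    (h : ∀ a, #{i | f i = a} = #{i | f' i = a}) : ∃ σ : Perm ι, ∀ i, f (σ⁻¹ i) = f' i := by
  have e : ∀ a, Nonempty ({i // f' i = a} ≃ {i // f i = a}) := fun a => by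
    rw [← Fintype.card_eq, Fintype.card_subtype, Fintype.card_subtype, h]
  let τ : Perm ι := Equiv.ofFiberEquiv fun a => (e a).some
  refine ⟨τ⁻¹, fun i => ?_⟩
  rw [inv_inv]
  exact Equiv.ofFiberEquiv_map (fun a => (e a).some) i

/-- Two injections with values in a finite set that has as many elements as their domain differ by
a permutation of the domain. -/
theorem exists_perm_of_injective {A : Type*} (s : Finset A) (hs : #s = Fintype.card ι)
    (f f' : ι → A) (hf : f.Injective) (hf' : f'.Injective) (hfs : ∀ i, f i ∈ s)
    (hfs' : ∀ i, f' i ∈ s) : ∃ σ : Perm ι, ∀ i, f (σ⁻¹ i) = f' i := by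
  have hc : Fintype.card ι = Fintype.card s := by rw [Fintype.card_coe, hs]
  let e : ι ≃ s := Equiv.ofBijective (fun i => ⟨f i, hfs i⟩)
    ((Fintype.bijective_iff_injective_and_card _).2
      ⟨fun i j h => hf (congrArg Subtype.val h), hc⟩)
  let e' : ι ≃ s := Equiv.ofBijective (fun i => ⟨f' i, hfs' i⟩)
    ((Fintype.bijective_iff_injective_and_card _).2
      ⟨fun i j h => hf' (congrArg Subtype.val h), hc⟩)
  refine ⟨e.trans e'.symm, fun i => ?_⟩
  have := congrArg Subtype.val (e.apply_symm_apply (e' i))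
  exact this

variable {x y : ι → ℕ} {μ ν : YoungDiagram}

theorem card_rows_lt (hx : ∀ a, #{i | x i = a} = ν.rowLen a) (j : ℕ) :
    #{i | x i < j} = #{c ∈ ν.cells | c.1 < j} := by
  rw [Finset.card_eq_sum_card_fiberwise (f := x) (t := Finset.range j) (by intro i; simp),
    Finset.card_eq_sum_card_fiberwise (f := Prod.fst) (t := Finset.range j) (by intro i; simp)]
  refine Finset.sum_congr rfl fun a ha => ?_
  rw [Finset.mem_range] at ha
  rw [Finset.filter_filter, Finset.filter_filter]
  have h1 : ({i | x i < j ∧ x i = a} : Finset ι) = ({i | x i = a} : Finset ι) := by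
    ext i
    simp only [Finset.mem_filter, Finset.mem_univ, true_and]
    omega
  have h2 : ({c ∈ ν.cells | c.1 < j ∧ c.1 = a} : Finset (ℕ × ℕ)) = ν.row a := by
    ext c
    simp only [Finset.mem_filter, YoungDiagram.mem_row_iff, YoungDiagram.mem_cells]
    refine and_congr_right fun _ => ?_
    omega
  rw [h1, h2, hx, YoungDiagram.rowLen_eq_card]

/-- The number of cells in column `b` and the first `j` rows. -/
theorem card_column_lt (b j : ℕ) :
    #{c ∈ μ.cells | c.1 < j ∧ c.2 = b} = min j (μ.colLen b) := by
  have : ({c ∈ μ.cells | c.1 < j ∧ c.2 = b} : Finset (ℕ × ℕ)) =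
      Finset.range (min j (μ.colLen b)) ×ˢ {b} := by
    ext ⟨a, c⟩
    simp only [Finset.mem_filter, YoungDiagram.mem_cells, Finset.mem_product, Finset.mem_range,
      Finset.mem_singleton, lt_min_iff]
    constructor
    · rintro ⟨h, h1, rfl⟩
      exact ⟨⟨h1, YoungDiagram.mem_iff_lt_colLen.1 h⟩, rfl⟩
    · rintro ⟨⟨h1, h⟩, rfl⟩
      exact ⟨YoungDiagram.mem_iff_lt_colLen.2 h, h1, rfl⟩
  rw [this]
  simp

theorem card_column_le (hxy : Function.Injective fun i => (x i, y i))
    (hy : ∀ b, #{i | y i = b} = μ.colLen b) (b j : ℕ) :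
    #{i | x i < j ∧ y i = b} ≤ #{c ∈ μ.cells | c.1 < j ∧ c.2 = b} := by
  rw [card_column_lt]
  refine le_min ?_ ?_
  · rw [← Finset.card_range j]
    refine Finset.card_le_card_of_injOn x (by intro i; simp +contextual) ?_
    intro i hi i' hi' h
    simp only [Finset.coe_filter, Finset.mem_univ, true_and, Set.mem_ofPred_eq] at hi hi'
    exact hxy (Prod.ext h (hi.2.trans hi'.2.symm))
  · rw [← hy]
    refine Finset.card_le_card fun i => ?_
    simp +contextual

/-- The easy half of the Gale–Ryser theorem: a zero-one matrix with the row sums of `ν` and the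
column sums of `μ` exists only if `μ` dominates `ν`. -/
theorem card_cells_le (hxy : Function.Injective fun i => (x i, y i))
    (hx : ∀ a, #{i | x i = a} = ν.rowLen a) (hy : ∀ b, #{i | y i = b} = μ.colLen b) (j : ℕ) :
    #{c ∈ ν.cells | c.1 < j} ≤ #{c ∈ μ.cells | c.1 < j} := by
  classical
  rw [← card_rows_lt hx]
  let t : Finset ℕ := Finset.univ.image y ∪ μ.cells.image Prod.snd
  rw [Finset.card_eq_sum_card_fiberwise (f := y) (t := t) (by intro i; simp [t]),
    Finset.card_eq_sum_card_fiberwise (f := Prod.snd) (t := t)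
      (by intro c hc; simp at hc; simp [t]; exact Or.inr ⟨_, hc.1⟩)]
  simp only [Finset.filter_filter]
  exact Finset.sum_le_sum fun b _ => card_column_le hxy hy b j

theorem eq_of_card_cells_eq
    (h : ∀ j, #{c ∈ ν.cells | c.1 < j} = #{c ∈ μ.cells | c.1 < j}) : ν = μ := by
  have hrow : ∀ (κ : YoungDiagram) (j : ℕ),
      #{c ∈ κ.cells | c.1 < j + 1} = #{c ∈ κ.cells | c.1 < j} + κ.rowLen j := fun κ j => by
    rw [YoungDiagram.rowLen_eq_card, ← Finset.card_union_of_disjoint]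
    · congr 1
      ext c
      simp only [Finset.mem_filter, Finset.mem_union, YoungDiagram.mem_row_iff,
        YoungDiagram.mem_cells, ← and_or_left]
      refine and_congr_right fun _ => ?_
      omega
    · rw [Finset.disjoint_left]
      intro c hc hc'
      have h1 := (Finset.mem_filter.1 hc).2
      have h2 := (YoungDiagram.mem_row_iff.1 hc').2
      omega
  have hlen : ∀ j, ν.rowLen j = μ.rowLen j := fun j => by
    have h1 := hrow ν j
    have h2 := hrow μ j
    rw [h, h] at h1
    omega
  ext ⟨a, b⟩
  rw [YoungDiagram.mem_cells, YoungDiagram.mem_cells, YoungDiagram.mem_iff_lt_rowLen,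
    YoungDiagram.mem_iff_lt_rowLen, hlen]

/-- The only zero-one matrix with the row and column sums of `μ` is the diagram of `μ` itself:
equality in the dominance estimate forces every column to be top justified. -/
theorem mem_diagram (hxy : Function.Injective fun i => (x i, y i))
    (hx : ∀ a, #{i | x i = a} = μ.rowLen a) (hy : ∀ b, #{i | y i = b} = μ.colLen b) (i : ι) :
    (x i, y i) ∈ μ := by
  classical
  let t : Finset ℕ := Finset.univ.image y ∪ μ.cells.image Prod.snd
  have hsum := card_rows_lt hx (μ.colLen (y i))
  rw [Finset.card_eq_sum_card_fiberwise (f := y) (t := t) (by intro i; simp [t]),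
    Finset.card_eq_sum_card_fiberwise (f := Prod.snd) (t := t)
      (by intro c hc; simp at hc; simp [t]; exact Or.inr ⟨_, hc.1⟩)] at hsum
  simp only [Finset.filter_filter] at hsum
  rw [Finset.sum_eq_sum_iff_of_le fun b _ => card_column_le hxy hy b _] at hsum
  have h1 := hsum (y i) (by simp [t])
  rw [card_column_lt, min_self, ← hy] at h1
  have h2 := Finset.eq_of_subset_of_card_le (by intro i'; simp +contextual) h1.ge
  have h3 : i ∈ ({i' | y i' = y i} : Finset ι) := by simp
  rw [← h2] at h3
  simp only [Finset.mem_filter, Finset.mem_univ, true_and, and_true] at h3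
  rw [YoungDiagram.mem_iff_lt_colLen, ← hy]
  exact h3

end Fillings

/-! ### Words and pairs of words -/

section Words

variable {n r : ℕ}

theorem isFreePair_iff {B C : Type*} (x : Fin n → B) (y : Fin n → C) :
    IsFreePair x y ↔ Function.Injective fun i => (x i, y i) := by
  refine ⟨fun h i j hij => h.eq_of_eq (congrArg Prod.fst hij) (congrArg Prod.snd hij),
    fun h σ hx hy => ?_⟩
  have : σ⁻¹ = 1 := Equiv.ext fun i => h (Prod.ext (congrFun hx i) (congrFun hy i))
  rwa [inv_eq_one] at this

theorem perm_ofFn_iff {B : Type*} [DecidableEq B] [BEq B] [LawfulBEq B] (w : Fin n → B)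
    (l : List B) :
    (List.ofFn w).Perm l ↔ ∀ b, #{i | w i = b} = l.count b := by
  rw [List.perm_iff_count]
  refine forall_congr' fun b => ?_
  rw [List.ofFn_eq_map, List.count, List.countP_map, List.countP_eq_length_filter]
  have : #{i | w i = b} = ((List.finRange n).filter ((fun x => x == b) ∘ w)).length := by
    rw [← List.toFinset_card_of_nodup ((List.nodup_finRange n).filter _)]
    congr 1
    ext i
    simp
  rw [this]

theorem count_canonicalWord (μ : YoungDiagram) (a : Fin n) :
    (canonicalWord n μ).count a = μ.rowLen a := by
  rw [canonicalWord, List.count_flatMap]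
  have : ((List.finRange n).map (List.count a ∘ fun a : Fin n => List.replicate (μ.rowLen a) a)) =
      (List.finRange n).map fun b => if b = a then μ.rowLen b else 0 := by
    refine List.map_congr_left fun b _ => ?_
    simp [List.count_replicate]
  rw [this, ← List.sum_toFinset _ (List.nodup_finRange n)]
  simp

theorem count_canonicalMultiword (p : MultiPartition r n) (a : Fin n) (k : Fin r) :
    (canonicalMultiword p).count (a, k) = (p.part k).rowLen a := by
  rw [canonicalMultiword, List.count_flatMap]
  have : ((List.finRange r).map (List.count (a, k) ∘
      fun k : Fin r => (canonicalWord n (p.part k)).map fun a => (a, k))) =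
      (List.finRange r).map fun j => if j = k then (p.part k).rowLen a else 0 := by
    refine List.map_congr_left fun j _ => ?_
    by_cases hj : j = k
    · subst hj
      simp only [Function.comp_apply, if_true]
      rw [← count_canonicalWord]
      exact List.count_map_of_injective _ (fun a : Fin n => (a, j))
        (fun a b h => congrArg Prod.fst h) a
    · simp only [Function.comp_apply, if_neg hj]
      refine List.count_eq_zero.2 fun h => ?_
      obtain ⟨b, _, hb⟩ := List.mem_map.1 h
      exact hj (congrArg Prod.snd hb)
  rw [this, ← List.sum_toFinset _ (List.nodup_finRange r)]
  simp

theorem perm_canonicalWord_iff (μ : YoungDiagram) (w : Fin n → Fin n) :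
    (List.ofFn w).Perm (canonicalWord n μ) ↔ ∀ a, #{i | w i = a} = μ.rowLen a := by
  simp_rw [perm_ofFn_iff, count_canonicalWord]

theorem perm_canonicalMultiword_iff (p : MultiPartition r n) (w : Fin n → Fin n × Fin r) :
    (List.ofFn w).Perm (canonicalMultiword p) ↔
      ∀ k (a : Fin n), #{i | w i = (a, k)} = (p.part k).rowLen a := by
  rw [perm_ofFn_iff, Prod.forall, forall_comm]
  exact forall_congr' fun k => forall_congr' fun a => by rw [count_canonicalMultiword]

/-- Words that are rearrangements of the same list lie in one orbit of the symmetric group. -/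
theorem exists_smul_eq {B : Type*} {l : List B} (w w' : Rearrangements n l) :
    ∃ σ : Perm (Fin n), σ • w = w' := by
  classical
  obtain ⟨σ, hσ⟩ := exists_perm_of_card_fiber_eq w.1 w'.1 fun b => by
    rw [(perm_ofFn_iff _ _).1 w.2, (perm_ofFn_iff _ _).1 w'.2]
  exact ⟨σ, Subtype.ext (funext hσ)⟩

theorem rowLen_le_card (μ : YoungDiagram) (a : ℕ) : μ.rowLen a ≤ μ.card := by
  rw [YoungDiagram.rowLen_eq_card]
  exact Finset.card_le_card (Finset.filter_subset _ _)

theorem card_transpose (μ : YoungDiagram) : μ.transpose.card = μ.card := by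
  simp [YoungDiagram.transpose, YoungDiagram.card]

theorem lt_card_of_mem {μ : YoungDiagram} {a b : ℕ} (h : (a, b) ∈ μ) :
    a < μ.card ∧ b < μ.card := by
  refine ⟨?_, (YoungDiagram.mem_iff_lt_rowLen.1 h).trans_le (rowLen_le_card _ _)⟩
  rw [← card_transpose]
  refine lt_of_lt_of_le ?_ (rowLen_le_card _ b)
  rw [YoungDiagram.rowLen_transpose]
  exact YoungDiagram.mem_iff_lt_colLen.1 h

theorem rowLen_eq_zero {μ : YoungDiagram} {a : ℕ} (h : μ.card ≤ a) : μ.rowLen a = 0 := by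
  by_contra h0
  have := (lt_card_of_mem (YoungDiagram.mem_iff_lt_rowLen.2 (Nat.pos_of_ne_zero h0))).1
  omega

theorem MultiPartition.card_part_le (p : MultiPartition r n) (k : Fin r) :
    (p.part k).card ≤ n :=
  (Finset.single_le_sum (f := fun k => (p.part k).card) (fun _ _ => Nat.zero_le _)
    (Finset.mem_univ k)).trans_eq p.sum_card

/-- The fibres of a word of shape `μ`, with letters read as natural numbers. -/
theorem card_letter {μ : YoungDiagram} (hμ : μ.card ≤ n) (w : X n μ) (a : ℕ) :
    #{i | (w.1 i : ℕ) = a} = μ.rowLen a := by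
  by_cases ha : a < n
  · rw [← (perm_canonicalWord_iff μ w.1).1 w.2 ⟨a, ha⟩]
    simp [Fin.ext_iff]
  · rw [rowLen_eq_zero (by omega), Finset.card_eq_zero, Finset.filter_eq_empty_iff]
    intro i _ h
    exact ha (h ▸ (w.1 i).2)

theorem card_filter_subtype (P Q : Fin n → Prop) [DecidablePred P] [DecidablePred Q] :
    #{i : {i // P i} | Q i.1} = #{i | P i ∧ Q i} := by
  rw [← Finset.card_map (Function.Embedding.subtype _)]
  congr 1
  ext i
  simp [and_comm]

/-- The fibres of the radii of a multiword over the positions of phase `k`. -/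
theorem card_radius (p : MultiPartition r n) (w : MX p) (k : Fin r) (a : ℕ) :
    #{i : {i // (w.1 i).2 = k} | ((w.1 i.1).1 : ℕ) = a} = (p.part k).rowLen a := by
  rw [card_filter_subtype (fun i => (w.1 i).2 = k) fun i => ((w.1 i).1 : ℕ) = a]
  by_cases ha : a < n
  · rw [← (perm_canonicalMultiword_iff p w.1).1 w.2 k ⟨a, ha⟩]
    simp [Prod.ext_iff, Fin.ext_iff, and_comm]
  · rw [rowLen_eq_zero ((p.card_part_le k).trans (by omega)), Finset.card_eq_zero,
      Finset.filter_eq_empty_iff]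
    rintro i _ ⟨_, h⟩
    exact ha (h ▸ (w.1 i).1.2)

end Words

/-! ### Free pairs of words -/

section FreePairs

variable {n r : ℕ}

/-- For a word `y` of shape `μᵗ`, the words `x` of shape `μ` such that `(x, y)` is free form one
orbit of the stabilizer of `y`. -/
theorem exists_stabilizer_smul_eq {μ : YoungDiagram} (hμ : μ.card = n) (y : X n μ.transpose)
    (x x' : X n μ) (h : IsFreePair x.1 y.1) (h' : IsFreePair x'.1 y.1) :
    ∃ σ : Perm (Fin n), σ • y = y ∧ σ • x = x' := by
  have hy : ∀ b, #{i | (y.1 i : ℕ) = b} = μ.colLen b := fun b => by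
    rw [card_letter ((card_transpose μ).le.trans hμ.le), YoungDiagram.rowLen_transpose]
  have inj : ∀ z : X n μ, IsFreePair z.1 y.1 →
      Function.Injective fun i => ((z.1 i : ℕ), (y.1 i : ℕ)) := fun z hz i j hij => by
    refine (isFreePair_iff _ _).1 hz ?_
    simpa [Fin.ext_iff] using hij
  obtain ⟨σ, hσ⟩ := exists_perm_of_injective μ.cells (by rw [Fintype.card_fin]; exact hμ) _ _
    (inj x h) (inj x' h')
    (fun i => mem_diagram (inj x h) (card_letter hμ.le x) hy i)
    (fun i => mem_diagram (inj x' h') (card_letter hμ.le x') hy i)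
  refine ⟨σ, Subtype.ext (funext fun i => ?_), Subtype.ext (funext fun i => ?_)⟩
  · exact Fin.ext (congrArg Prod.snd (hσ i))
  · exact Fin.ext (congrArg Prod.fst (hσ i))

/-- Numbering the cells of the diagram gives a free pair: the words of row and column indices. -/
theorem exists_isFreePair {μ : YoungDiagram} (hμ : μ.card = n) :
    ∃ (x : X n μ) (y : X n μ.transpose), IsFreePair x.1 y.1 := by
  let e : Fin n ≃ μ.cells := (Fintype.equivFinOfCardEq (by simpa using hμ)).symm
  have he : ∀ i, ((e i).1.1, (e i).1.2) ∈ μ := fun i => (e i).2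
  have hcard : ∀ P : ℕ × ℕ → Prop, ∀ [DecidablePred P],
      #{i | P (e i).1} = #{c ∈ μ.cells | P c} := fun P _ => by
    rw [← Finset.card_map (e.toEmbedding.trans (Function.Embedding.subtype _))]
    congr 1
    ext c
    simp only [Finset.mem_map, Finset.mem_filter, Finset.mem_univ, true_and]
    constructor
    · rintro ⟨i, hi, rfl⟩
      exact ⟨(e i).2, hi⟩
    · rintro ⟨hc, hP⟩
      exact ⟨e.symm ⟨c, hc⟩, by simpa using hP, by simp⟩
  refine ⟨⟨fun i => ⟨(e i).1.1, hμ ▸ (lt_card_of_mem (he i)).1⟩, ?_⟩,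
    ⟨fun i => ⟨(e i).1.2, hμ ▸ (lt_card_of_mem (he i)).2⟩, ?_⟩, ?_⟩
  · rw [perm_canonicalWord_iff]
    intro a
    rw [YoungDiagram.rowLen_eq_card]
    simp only [Fin.ext_iff]
    exact hcard fun c => c.1 = a
  · rw [perm_canonicalWord_iff]
    intro b
    rw [YoungDiagram.rowLen_transpose, YoungDiagram.colLen_eq_card]
    simp only [Fin.ext_iff]
    exact hcard fun c => c.2 = b
  · rw [isFreePair_iff]
    intro i j hij
    simp only [Prod.mk.injEq, Fin.mk.injEq] at hij
    exact e.injective (Subtype.ext (Prod.ext hij.1 hij.2))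

/-- Restricting a free pair of multiwords with equal phases to one phase. -/
theorem injective_of_phase {x y : Fin n → Fin n × Fin r} (hp : ∀ i, (x i).2 = (y i).2)
    (h : IsFreePair x y) (k : Fin r) : Function.Injective
      fun i : {i // (x i).2 = k} => (((x i.1).1 : ℕ), ((y i.1).1 : ℕ)) := by
  rintro ⟨i, hi⟩ ⟨j, hj⟩ hij
  simp only [Prod.mk.injEq, Fin.val_inj] at hij
  exact Subtype.ext ((isFreePair_iff _ _).1 h (Prod.ext (Prod.ext hij.1 (hi.trans hj.symm))
    (Prod.ext hij.2 ((hp i).symm.trans ((hi.trans hj.symm).trans (hp j))))))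

theorem card_radius_of_phase (p : MultiPartition r n) (x : Fin n → Fin n × Fin r)
    (y : MX p.transpose) (hp : ∀ i, (x i).2 = (y.1 i).2) (k : Fin r) (b : ℕ) :
    #{i : {i // (x i).2 = k} | ((y.1 i.1).1 : ℕ) = b} = (p.part k).colLen b := by
  rw [← YoungDiagram.rowLen_transpose]
  refine Eq.trans ?_ (card_radius p.transpose y k b)
  rw [card_filter_subtype (fun i => (x i).2 = k) fun i => ((y.1 i).1 : ℕ) = b,
    card_filter_subtype (fun i => (y.1 i).2 = k) fun i => ((y.1 i).1 : ℕ) = b]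
  simp_rw [hp]

/-- A free pair of multiwords of shapes `q` and `pᵗ` with equal phases exists only if `p` dominates
`q` in each component. -/
theorem card_cells_le_of_isFreePair (p q : MultiPartition r n) (x : MX q) (y : MX p.transpose)
    (hp : ∀ i, (x.1 i).2 = (y.1 i).2) (h : IsFreePair x.1 y.1) (k : Fin r) (j : ℕ) :
    #{c ∈ (q.part k).cells | c.1 < j} ≤ #{c ∈ (p.part k).cells | c.1 < j} :=
  card_cells_le (injective_of_phase hp h k) (card_radius q x k)
    (card_radius_of_phase p x.1 y hp k) j

theorem exists_stabilizer_smul_eq_multi (p : MultiPartition r n) (y : MX p.transpose)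
    (x x' : MX p) (hp : ∀ i, (x.1 i).2 = (y.1 i).2) (h : IsFreePair x.1 y.1)
    (hp' : ∀ i, (x'.1 i).2 = (y.1 i).2) (h' : IsFreePair x'.1 y.1) :
    ∃ σ : Perm (Fin n), σ • y = y ∧ σ • x = x' := by
  let f : MX p → Fin n → (k : Fin r) × (ℕ × ℕ) :=
    fun z i => ⟨(y.1 i).2, ((z.1 i).1, (y.1 i).1)⟩
  have inj : ∀ z : MX p, (∀ i, (z.1 i).2 = (y.1 i).2) → IsFreePair z.1 y.1 →
      Function.Injective (f z) := fun z hz hf i j hij => by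
    simp only [f, Sigma.mk.injEq, heq_eq_eq, Prod.mk.injEq, Fin.val_inj] at hij
    exact (isFreePair_iff _ _).1 hf (Prod.ext (Prod.ext hij.2.1 (by rw [hz, hz, hij.1]))
      (Prod.ext hij.2.2 hij.1))
  have mem : ∀ z : MX p, (∀ i, (z.1 i).2 = (y.1 i).2) → IsFreePair z.1 y.1 →
      ∀ i, f z i ∈ Finset.univ.sigma fun k => (p.part k).cells := fun z hz hf i => by
    rw [Finset.mem_sigma]
    refine ⟨Finset.mem_univ _, ?_⟩
    exact mem_diagram (injective_of_phase hz hf (y.1 i).2) (card_radius p z _)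
      (card_radius_of_phase p z.1 y hz _) ⟨i, hz i⟩
  obtain ⟨σ, hσ⟩ := exists_perm_of_injective (Finset.univ.sigma fun k => (p.part k).cells)
    (by rw [Finset.card_sigma, Fintype.card_fin]; exact p.sum_card) (f x) (f x')
    (inj x hp h) (inj x' hp' h') (mem x hp h) (mem x' hp' h')
  have hσ' : ∀ i, (y.1 (σ⁻¹ i)).2 = (y.1 i).2 ∧ (x.1 (σ⁻¹ i)).1 = (x'.1 i).1 ∧
      (y.1 (σ⁻¹ i)).1 = (y.1 i).1 := fun i => by
    have := hσ i
    simpa only [f, Sigma.mk.injEq, heq_eq_eq, Prod.mk.injEq, Fin.val_inj] using this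
  refine ⟨σ, Subtype.ext (funext fun i => ?_), Subtype.ext (funext fun i => ?_)⟩
  · exact Prod.ext (hσ' i).2.2 (hσ' i).1
  · exact Prod.ext (hσ' i).2.1 (by rw [smul_val, hp, hp', (hσ' i).1])

end FreePairs

/-! ### Assembling words from blocks -/

theorem sign_sigmaCongrRight {ι : Type*} [Fintype ι] [DecidableEq ι] {β : ι → Type*}
    [∀ k, Fintype (β k)] [∀ k, DecidableEq (β k)] (σ : ∀ k, Perm (β k)) :
    Perm.sign (Perm.sigmaCongrRight σ) = ∏ k, Perm.sign (σ k) := by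
  let f : (∀ k, Perm (β k)) →* ℤˣ := Perm.sign.comp (Perm.sigmaCongrRightHom β)
  let g : (∀ k, Perm (β k)) →* ℤˣ := ∏ k, Perm.sign.comp (Pi.evalMonoidHom _ k)
  have hfg : f = g := by
    refine MonoidHom.pi_ext fun k τ => ?_
    have h1 : g (Pi.mulSingle k τ) = Perm.sign τ := by
      simp only [g, MonoidHom.finsetProd_apply, MonoidHom.comp_apply, Pi.evalMonoidHom_apply]
      rw [Finset.prod_eq_single k]
      · simp
      · intro j _ hj
        simp [Pi.mulSingle_eq_of_ne hj]
      · simp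
    let e : β k ≃ {s : Sigma β // s.1 = k} :=
      { toFun := fun b => ⟨⟨k, b⟩, rfl⟩
        invFun := fun s => s.2 ▸ s.1.2
        left_inv := fun b => rfl
        right_inv := by rintro ⟨⟨j, b⟩, rfl⟩; rfl }
    have h2 : Perm.sigmaCongrRight (Pi.mulSingle k τ) = τ.extendDomain e := by
      ext1 ⟨j, b⟩
      by_cases hj : j = k
      · subst hj
        have := Perm.extendDomain_apply_image τ e b
        rw [show ((e b : {s : Sigma β // s.1 = j}) : Sigma β) = ⟨j, b⟩ from rfl] at this
        rw [this]
        simp [e]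
      · rw [Perm.extendDomain_apply_not_subtype τ e (b := ⟨j, b⟩) hj]
        simp [Pi.mulSingle_eq_of_ne hj]
    rw [h1]
    change Perm.sign (Perm.sigmaCongrRight (Pi.mulSingle k τ)) = _
    rw [h2, Perm.sign_extendDomain]
  have := DFunLike.congr_fun hfg σ
  simpa [f, g, MonoidHom.finsetProd_apply] using this

section Assemble

variable {r n : ℕ} {m : Fin r → ℕ} (h : ∑ k, m k = n)

include h in
theorem block_le (k : Fin r) : m k ≤ n :=
  h ▸ Finset.single_le_sum (fun _ _ => Nat.zero_le _) (Finset.mem_univ k)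

/-- The multiword whose letters at the positions of the `k`-th block have phase `k` and are
otherwise those of the word `w k`. -/
def assemble (w : ∀ k, Fin (m k) → Fin (m k)) (i : Fin n) : Fin n × Fin r :=
  (Fin.castLE (block_le h ((blocks m h).symm i).1) (w _ ((blocks m h).symm i).2),
    ((blocks m h).symm i).1)

theorem assemble_blocks (w : ∀ k, Fin (m k) → Fin (m k)) (k : Fin r) (j : Fin (m k)) :
    assemble h w (blocks m h ⟨k, j⟩) = (Fin.castLE (block_le h k) (w k j), k) :=
  congrArg (fun s : (k : Fin r) × Fin (m k) => (Fin.castLE (block_le h s.1) (w s.1 s.2), s.1))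
    (symm_apply_apply (blocks m h) ⟨k, j⟩)

theorem forall_blocks {P : Fin n → Prop} (hP : ∀ k j, P (blocks m h ⟨k, j⟩)) (i : Fin n) : P i := by
  obtain ⟨⟨k, j⟩, rfl⟩ := (blocks m h).surjective i
  exact hP k j

/-- Positions are ordered by block first. -/
theorem blocks_le {k k' : Fin r} {j : Fin (m k)} {j' : Fin (m k')}
    (hle : blocks m h ⟨k, j⟩ ≤ blocks m h ⟨k', j'⟩) :
    k < k' ∨ k = k' ∧ (j : ℕ) ≤ j' := by
  have hv : ∀ (k : Fin r) (j : Fin (m k)),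
      (blocks m h ⟨k, j⟩ : ℕ) = ∑ i ∈ Finset.univ.filter (· < k), m i + j := fun k j => by
    have h1 : (blocks m h ⟨k, j⟩ : ℕ) = (finSigmaFinEquiv ⟨k, j⟩ : ℕ) := rfl
    rw [h1, finSigmaFinEquiv_apply]
    congr 1
    refine Finset.sum_bij (fun i _ => Fin.castLE k.2.le i) (fun i _ => ?_) (fun i _ j _ hij => ?_)
      (fun i hi => ?_) (fun i _ => rfl)
    · simp only [Finset.mem_filter, Finset.mem_univ, true_and]
      exact i.2
    · exact Fin.castLE_injective _ hij
    · exact ⟨⟨i, (Finset.mem_filter.1 hi).2⟩, Finset.mem_univ _, rfl⟩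
  have hle' : (blocks m h ⟨k, j⟩ : ℕ) ≤ blocks m h ⟨k', j'⟩ := hle
  rw [hv, hv] at hle'
  rcases lt_trichotomy k k' with hk | rfl | hk
  · exact Or.inl hk
  · exact Or.inr ⟨rfl, by omega⟩
  · exfalso
    have h2 : insert k' (Finset.univ.filter (· < k')) ⊆ Finset.univ.filter (· < k) := by
      intro i hi
      rw [Finset.mem_insert, Finset.mem_filter] at hi
      rw [Finset.mem_filter]
      refine ⟨Finset.mem_univ _, ?_⟩
      rcases hi with rfl | hi
      · exact hk
      · exact hi.2.trans hk
    have h3 := Finset.sum_le_sum_of_subset (f := m) h2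
    rw [Finset.sum_insert (by simp)] at h3
    have := j'.2
    omega

theorem perm_assemble (p : MultiPartition r n) (hm : ∀ k, (p.part k).card = m k)
    (w : ∀ k, X (m k) (p.part k)) :
    (List.ofFn (assemble h fun k => (w k).1)).Perm (canonicalMultiword p) := by
  rw [perm_canonicalMultiword_iff]
  intro k a
  rw [← card_letter (hm k).le (w k) a]
  symm
  refine Finset.card_bij (fun j _ => blocks m h ⟨k, j⟩) (fun j hj => ?_) (fun j _ j' _ hj => ?_) ?_
  · rw [Finset.mem_filter] at hj ⊢
    refine ⟨Finset.mem_univ _, ?_⟩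
    rw [assemble_blocks]
    exact Prod.ext (Fin.ext hj.2) rfl
  · simpa using hj
  · refine forall_blocks h fun k' j hj => ?_
    rw [Finset.mem_filter, assemble_blocks, Prod.mk.injEq] at hj
    obtain ⟨-, h1, rfl⟩ := hj
    exact ⟨j, Finset.mem_filter.2 ⟨Finset.mem_univ _, congrArg Fin.val h1⟩, rfl⟩

theorem isFreePair_assemble (x y : ∀ k, Fin (m k) → Fin (m k)) :
    IsFreePair (assemble h x) (assemble h y) ↔ ∀ k, IsFreePair (x k) (y k) := by
  simp_rw [isFreePair_iff]
  constructor
  · intro hinj k j j' hj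
    have : blocks m h ⟨k, j⟩ = blocks m h ⟨k, j'⟩ := by
      apply hinj
      simp only [Prod.mk.injEq] at hj
      simp only [assemble_blocks, hj.1, hj.2]
    simpa using this
  · intro hinj
    refine forall_blocks h fun k j => ?_
    refine forall_blocks h fun k' j' hj => ?_
    simp only [assemble_blocks, Prod.mk.injEq] at hj
    obtain ⟨⟨h1, rfl⟩, h2, -⟩ := hj
    rw [hinj k (Prod.ext (Fin.castLE_injective _ h1) (Fin.castLE_injective _ h2))]

/-- For assembled words the tableaux of the blocks are concatenated. -/
theorem multiFlat_assemble (x y : ∀ k, Fin (m k) → Fin (m k)) (hf : ∀ k, IsFreePair (x k) (y k)) :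
    multiFlat (assemble h x) (assemble h y) =
      (blocks m h).permCongr (Perm.sigmaCongrRight fun k => flat (x k) (y k)) := by
  let key : Fin n → Lex (Fin r × Lex (Fin n × Fin n)) := fun i =>
    toLex ((assemble h x i).2, toLex ((assemble h x i).1, (assemble h y i).1))
  have hkey : Function.Injective key := by
    intro i j hij
    have h0 := toLex.injective hij
    have h1 := congrArg Prod.fst h0
    have h2 := toLex.injective (congrArg Prod.snd h0)
    have h3 := congrArg Prod.fst h2
    have h4 := congrArg Prod.snd h2
    exact (isFreePair_iff _ _).1 ((isFreePair_assemble h x y).2 hf)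
      (Prod.ext (Prod.ext h3 h1) (Prod.ext h4 h1))
  have hperm : ∀ k j, (blocks m h).permCongr (Perm.sigmaCongrRight fun k => flat (x k) (y k))
      (blocks m h ⟨k, j⟩) = blocks m h ⟨k, flat (x k) (y k) j⟩ := fun k j => by
    rw [permCongr_apply, symm_apply_apply]
    rfl
  have hmono : Monotone (key ∘ (blocks m h).permCongr
      (Perm.sigmaCongrRight fun k => flat (x k) (y k))) := by
    refine forall_blocks h fun k j => ?_
    refine forall_blocks h fun k' j' hle => ?_
    rw [Function.comp_apply, Function.comp_apply, hperm, hperm]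
    simp only [key, assemble_blocks]
    rcases blocks_le h hle with hk | ⟨rfl, hj⟩
    · exact Prod.Lex.toLex_le_toLex.2 (Or.inl hk)
    · have hs : toLex (x k (flat (x k) (y k) j), y k (flat (x k) (y k) j)) ≤
          toLex (x k (flat (x k) (y k) j'), y k (flat (x k) (y k) j')) :=
        Tuple.monotone_sort (fun i => toLex (x k i, y k i)) hj
      rw [Prod.Lex.toLex_le_toLex] at hs
      refine Prod.Lex.toLex_le_toLex.2 (Or.inr ⟨rfl, ?_⟩)
      rw [Prod.Lex.toLex_le_toLex]
      exact hs.imp id (And.imp (fun h1 => congrArg (Fin.castLE (block_le h k)) h1) id)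
  have h2 := Tuple.unique_monotone (Tuple.monotone_sort key) hmono
  exact Equiv.ext fun i => hkey (congrFun h2 i)

theorem multiSpechtEntry_assemble (x y : ∀ k, Fin (m k) → Fin (m k)) :
    multiSpechtEntry (assemble h y) (assemble h x) = ∏ k, spechtEntry (y k) (x k) := by
  unfold multiSpechtEntry spechtEntry
  by_cases hf : ∀ k, IsFreePair (x k) (y k)
  · rw [if_pos ⟨fun i => rfl, (isFreePair_assemble h x y).2 hf⟩, multiFlat_assemble h x y hf,
      Perm.sign_permCongr, sign_sigmaCongrRight]
    simp only [hf, if_true]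
    push_cast
    rfl
  · rw [if_neg (fun h' => hf ((isFreePair_assemble h x y).1 h'.2))]
    push Not at hf
    obtain ⟨k, hk⟩ := hf
    rw [Finset.prod_eq_zero (Finset.mem_univ k)]
    rw [if_neg hk]

end Assemble

/-! ### The modules are irreducible and pairwise non-isomorphic -/

section SymmetricIrreducible

variable {n : ℕ} {μ : YoungDiagram}

theorem spechtVector_apply (y : X n μ.transpose) (x : X n μ) :
    spechtVector n μ y x = spechtEntry y.1 x.1 := by
  classical
  simp [spechtVector, Finsupp.finsetSum_apply, Finsupp.single_apply]

theorem symmetricRep_apply (σ : Perm (Fin n)) (u : X n μ →₀ ℂ) (x : X n μ) :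
    symmetricRep n μ σ u (σ • x) = u x :=
  Finsupp.mapDomain_apply (MulAction.injective σ) u x

theorem spechtEntry_smul (σ : Perm (Fin n)) {κ : YoungDiagram} (y : X n κ) (x : X n μ) :
    spechtEntry (σ • y).1 (σ • x).1 = ((Perm.sign σ : ℤ) : ℂ) * spechtEntry y.1 x.1 := by
  rw [spechtEntry_comp_inv σ y.1 x.1, ← mul_assoc]
  have := sign_mul_sign σ 1
  rw [mul_one] at this
  rw [this]
  simp
  rfl

theorem conj_spechtEntry (y x : Fin n → Fin n) :
    (starRingEnd ℂ) (spechtEntry y x) = spechtEntry y x := by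
  unfold spechtEntry
  split_ifs <;> simp

theorem spechtEntry_ne_zero_iff (y x : Fin n → Fin n) :
    spechtEntry y x ≠ 0 ↔ IsFreePair x y := by
  unfold spechtEntry
  split_ifs with h <;> simp [h]

/-- The sign character, with complex values. -/
def signHom (n : ℕ) : Perm (Fin n) →* ℂ where
  toFun σ := ((Perm.sign σ : ℤ) : ℂ)
  map_one' := by simp
  map_mul' σ τ := by simp

theorem signHom_apply (σ : Perm (Fin n)) : signHom n σ = ((Perm.sign σ : ℤ) : ℂ) := rfl

theorem signHom_mul_self (σ : Perm (Fin n)) : signHom n σ * signHom n σ = 1 := by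
  rw [signHom_apply]
  rcases Int.units_eq_one_or (Perm.sign σ) with h | h <;> simp [h]

theorem exists_swap_of_not_isFreePair {B C : Type*} {x : Fin n → B} {y : Fin n → C}
    (h : ¬IsFreePair x y) : ∃ σ : Perm (Fin n), Perm.sign σ = -1 ∧
      (fun i => x (σ⁻¹ i)) = x ∧ (fun i => y (σ⁻¹ i)) = y := by
  rw [isFreePair_iff, Function.Injective] at h
  push Not at h
  obtain ⟨i, j, hij, hne⟩ := h
  exact ⟨swap i j, Perm.sign_swap hne, comp_swap_inv x (congrArg Prod.fst hij),
    comp_swap_inv y (congrArg Prod.snd hij)⟩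

/-- The Specht module of a symmetric group is irreducible. -/
theorem symmetricSpechtRep_isIrreducible (hμ : μ.card = n) :
    (symmetricSpechtRep n μ).IsIrreducible := by
  refine irreducible_of_span (symmetricSpecht n μ) (spechtVector n μ) rfl (fun y x => ?_)
    (fun y y' => ?_) ?_ (fun y => MulAction.stabilizer _ y)
    (fun y => (signHom n).comp (MulAction.stabilizer _ y).subtype) (fun y u hu => ?_)
    (fun y g u => ?_)
  · rw [spechtVector_apply, conj_spechtEntry]
  · obtain ⟨σ, rfl⟩ := exists_smul_eq y y'
    refine ⟨σ, signHom n σ, ?_⟩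
    rw [symmetricRep_spechtVector, smul_smul, ← signHom_apply, signHom_mul_self, one_smul]
  · obtain ⟨x, y, h⟩ := exists_isFreePair hμ
    refine ⟨y, fun h0 => ?_⟩
    have := spechtVector_apply y x
    rw [h0] at this
    exact (spechtEntry_ne_zero_iff _ _).2 h this.symm
  · have hu' : ∀ σ : Perm (Fin n), σ • y = y → ∀ x, u x = signHom n σ * u (σ • x) :=
      fun σ hσ x => by
        have := DFunLike.congr_fun (hu ⟨σ, hσ⟩) (σ • x)
        rw [symmetricRep_apply] at this
        exact this
    have hzero : ∀ x : X n μ, ¬IsFreePair x.1 y.1 → u x = 0 := fun x hx => by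
      obtain ⟨σ, h1, h2, h3⟩ := exists_swap_of_not_isFreePair hx
      have := hu' σ (Subtype.ext h3) x
      rw [show σ • x = x from Subtype.ext h2, signHom_apply, h1] at this
      simpa [self_eq_neg] using this
    by_cases hex : ∃ x0 : X n μ, IsFreePair x0.1 y.1
    · obtain ⟨x0, h0⟩ := hex
      have hne := (spechtEntry_ne_zero_iff _ _).2 h0
      refine ⟨u x0 / spechtEntry y.1 x0.1, Finsupp.ext fun x => ?_⟩
      rw [Finsupp.smul_apply, spechtVector_apply, smul_eq_mul]
      by_cases hx : IsFreePair x.1 y.1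
      · obtain ⟨σ, hσ, rfl⟩ := exists_stabilizer_smul_eq hμ y x0 x h0 hx
        have h1 := spechtEntry_smul σ y x0
        rw [hσ] at h1
        rw [h1, hu' σ hσ x0, ← signHom_apply]
        field_simp
        linear_combination (-u (σ • x0)) * signHom_mul_self σ
      · rw [hzero x hx, of_not_not (mt (spechtEntry_ne_zero_iff _ _).1 hx), mul_zero]
    · push Not at hex
      refine ⟨0, Finsupp.ext fun x => ?_⟩
      rw [hzero x (hex x)]
      simp
  · have hg : (g : Perm (Fin n)) • y = y := g.2
    rw [← Equiv.sum_comp (MulAction.toPerm (g : Perm (Fin n))), Finset.mul_sum]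
    refine Finset.sum_congr rfl fun x _ => ?_
    rw [MulAction.toPerm_apply, symmetricRep_apply, spechtVector_apply, spechtVector_apply]
    have h1 := spechtEntry_smul (g : Perm (Fin n)) y x
    rw [hg] at h1
    rw [h1, MonoidHom.comp_apply, Subgroup.coe_subtype, signHom_apply, mul_assoc]

end SymmetricIrreducible

section MultiIrreducible

variable {r n : ℕ}

theorem multiSpechtVector_apply (p : MultiPartition r n) (y : MX p.transpose) (x : MX p) :
    multiSpechtVector p y x = multiSpechtEntry y.1 x.1 := by
  classical
  simp [multiSpechtVector, Finsupp.finsetSum_apply, Finsupp.single_apply]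

theorem monomialRep_apply (p : MultiPartition r n) (g : MonomialGroup r n) (u : MX p →₀ ℂ)
    (x : MX p) : monomialRep p g u (g.right • x) = weight g.left (g.right • x).1 * u x := by
  classical
  induction u using Finsupp.induction_linear with
  | zero => simp
  | add a b ha hb => simp [ha, hb, mul_add]
  | single z c =>
    have h := monomialAct_single p g z c
    change monomialAct p g _ _ = _
    rw [h, Finsupp.single_apply, Finsupp.single_apply]
    by_cases hz : z = x
    · subst hz
      simp [mul_comm]
    · simp [hz]

theorem multiSpechtEntry_smul (σ : Perm (Fin n)) {l l' : List (Fin n × Fin r)}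
    (y : Rearrangements n l) (x : Rearrangements n l') :
    multiSpechtEntry (σ • y).1 (σ • x).1 = signHom n σ * multiSpechtEntry y.1 x.1 := by
  rw [multiSpechtEntry_comp_inv σ y.1 x.1, ← mul_assoc, ← signHom_apply, signHom_mul_self, one_mul]
  rfl

theorem conj_multiSpechtEntry (y x : Fin n → Fin n × Fin r) :
    (starRingEnd ℂ) (multiSpechtEntry y x) = multiSpechtEntry y x := by
  unfold multiSpechtEntry
  split_ifs <;> simp

theorem multiSpechtEntry_ne_zero_iff (y x : Fin n → Fin n × Fin r) :
    multiSpechtEntry y x ≠ 0 ↔ (∀ i, (x i).2 = (y i).2) ∧ IsFreePair x y := by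
  unfold multiSpechtEntry
  split_ifs with h <;> simp [h]

theorem multiSpechtVector_ne_zero (p : MultiPartition r n) (x : MX p) (y : MX p.transpose)
    (h : (∀ i, (x.1 i).2 = (y.1 i).2) ∧ IsFreePair x.1 y.1) : multiSpechtVector p y ≠ 0 :=
  fun h0 => (multiSpechtEntry_ne_zero_iff _ _).2 h (by
    rw [← multiSpechtVector_apply, h0, Finsupp.zero_apply])

theorem weight_eq_of_phase {x y : Fin n → Fin n × Fin r} (hp : ∀ i, (x i).2 = (y i).2)
    (α : Fin n → rootsOfUnity r ℂ) : weight α x = weight α y :=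
  Finset.prod_congr rfl fun i _ => by rw [hp i]

/-- The stabilizer of a multiword in the monomial group, acting through the symmetric group. -/
def multiStabilizer {l : List (Fin n × Fin r)} (y : Rearrangements n l) :
    Subgroup (MonomialGroup r n) :=
  (MulAction.stabilizer (Perm (Fin n)) y).comap SemidirectProduct.rightHom

/-- The linear character by which the stabilizer of `y` acts on the vector `v_y`. -/
def multiStabilizerChar {l : List (Fin n × Fin r)} (y : Rearrangements n l) :
    multiStabilizer y →* ℂ where
  toFun g := signHom n g.1.right * weight g.1.left y.1
  map_one' := by simp [weight_one]
  map_mul' g h := by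
    have hg : g.1.right • y = y := g.2
    have h1 := weight_smul g.1.right h.1.left y
    rw [hg] at h1
    simp only [Subgroup.coe_mul, SemidirectProduct.mul_left, SemidirectProduct.mul_right,
      weight_mul, map_mul, h1]
    ring

/-- Two multiwords with different phases, or with a common transposition in their stabilizers, are
separated by the stabilizer of one of them. -/
theorem exists_separating {l l' : List (Fin n × Fin r)} (y : Rearrangements n l)
    (x : Rearrangements n l') (h : ¬((∀ i, (x.1 i).2 = (y.1 i).2) ∧ IsFreePair x.1 y.1)) :
    ∃ g : multiStabilizer y, g.1.right • x = x ∧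
      weight g.1.left x.1 ≠ multiStabilizerChar y g := by
  by_cases hp : ∀ i, (x.1 i).2 = (y.1 i).2
  · obtain ⟨σ, h1, h2, h3⟩ := exists_swap_of_not_isFreePair fun hf => h ⟨hp, hf⟩
    refine ⟨⟨⟨1, σ⟩, Subtype.ext h3⟩, Subtype.ext h2, ?_⟩
    change weight 1 x.1 ≠ signHom n σ * weight 1 y.1
    rw [weight_one, weight_one, signHom_apply, h1]
    norm_num
  · push Not at hp
    obtain ⟨i, hi⟩ := hp
    have hr : r ≠ 0 := by
      rintro rfl
      exact (x.1 i).2.elim0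
    have := NeZero.mk hr
    have hprim := Complex.isPrimitiveRoot_exp r hr
    -- The diagonal matrix with a primitive root of unity in position `i` detects the phase there.
    let ζ : rootsOfUnity r ℂ := rootsOfUnity.mkOfPowEq (Complex.exp (2 * Real.pi * Complex.I / r))
      hprim.pow_eq_one
    refine ⟨⟨⟨Pi.mulSingle i ζ, 1⟩, one_smul _ y⟩, one_smul _ x, ?_⟩
    change weight (Pi.mulSingle i ζ) x.1 ≠ signHom n 1 * weight (Pi.mulSingle i ζ) y.1
    have hw : ∀ w : Fin n → Fin n × Fin r, weight (Pi.mulSingle i ζ) w =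
        Complex.exp (2 * Real.pi * Complex.I / r) ^ ((w i).2 : ℕ) := fun w => by
      rw [weight, Finset.prod_eq_single i]
      · simp [ζ]
      · intro j _ hj
        simp [Pi.mulSingle_eq_of_ne hj]
      · simp
    rw [map_one, one_mul, hw, hw]
    intro h'
    exact hi (Fin.ext (hprim.pow_inj (x.1 i).2.2 (y.1 i).2.2 h'))

/-- A vector that transforms under the stabilizer of `y` like `v_y` is supported on words that form
free pairs with `y`. -/
theorem apply_eq_zero_of_not_isFreePair (q : MultiPartition r n) {l : List (Fin n × Fin r)}
    (y : Rearrangements n l) (u : MX q →₀ ℂ)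
    (hu : ∀ g : multiStabilizer y, monomialRep q g u = multiStabilizerChar y g • u) (x : MX q)
    (h : ¬((∀ i, (x.1 i).2 = (y.1 i).2) ∧ IsFreePair x.1 y.1)) : u x = 0 := by
  obtain ⟨g, h1, h2⟩ := exists_separating y x h
  have h3 := monomialRep_apply q g u x
  rw [hu, h1, Finsupp.smul_apply, smul_eq_mul] at h3
  by_contra h0
  exact h2 (mul_right_cancel₀ h0 h3).symm

/-- Free pairs of words for the components assemble to a free pair of multiwords.  The words of the
blocks are recorded because the characters are compared block by block. -/
theorem exists_isFreePair_multi (p : MultiPartition r n) :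
    ∃ (x y : ∀ k, Fin (p.part k).card → Fin (p.part k).card),
      (List.ofFn (assemble p.sum_card x)).Perm (canonicalMultiword p) ∧
      (List.ofFn (assemble p.sum_card y)).Perm (canonicalMultiword p.transpose) ∧
      (∀ k, (List.ofFn (x k)).Perm (canonicalWord _ (p.part k))) ∧
      (∀ k, (List.ofFn (y k)).Perm (canonicalWord _ (p.part k).transpose)) ∧
      ∀ k, IsFreePair (x k) (y k) := by
  choose x y h using fun k => exists_isFreePair (μ := p.part k) rfl
  exact ⟨fun k => (x k).1, fun k => (y k).1, perm_assemble p.sum_card p (fun _ => rfl) x,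
    perm_assemble p.sum_card p.transpose (fun k => card_transpose _) y,
    fun k => (x k).2, fun k => (y k).2, h⟩

/-- The modules `S^λ` of the monomial group are irreducible. -/
theorem multiSpechtRep_isIrreducible [NeZero r] (p : MultiPartition r n) :
    (multiSpechtRep p).IsIrreducible := by
  refine irreducible_of_span (multiSpecht p) (multiSpechtVector p) rfl (fun y x => ?_)
    (fun y y' => ?_) ?_ multiStabilizer multiStabilizerChar (fun y u hu => ?_)
    (fun y g u => ?_)
  · rw [multiSpechtVector_apply, conj_multiSpechtEntry]
  · obtain ⟨σ, rfl⟩ := exists_smul_eq y y'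
    refine ⟨⟨1, σ⟩, signHom n σ, ?_⟩
    rw [monomialRep_multiSpechtVector, smul_smul, ← signHom_apply, weight_one, mul_one,
      signHom_mul_self, one_smul]
  · obtain ⟨x, y, hx, hy, -, -, h⟩ := exists_isFreePair_multi p
    exact ⟨⟨_, hy⟩, multiSpechtVector_ne_zero p ⟨_, hx⟩ ⟨_, hy⟩
      ⟨fun _ => rfl, (isFreePair_assemble _ _ _).2 h⟩⟩
  · have hzero := apply_eq_zero_of_not_isFreePair p y u hu
    by_cases hex : ∃ x0 : MX p, (∀ i, (x0.1 i).2 = (y.1 i).2) ∧ IsFreePair x0.1 y.1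
    · obtain ⟨x0, h0⟩ := hex
      have hne := (multiSpechtEntry_ne_zero_iff _ _).2 h0
      refine ⟨u x0 / multiSpechtEntry y.1 x0.1, Finsupp.ext fun x => ?_⟩
      rw [Finsupp.smul_apply, multiSpechtVector_apply, smul_eq_mul]
      by_cases hx : (∀ i, (x.1 i).2 = (y.1 i).2) ∧ IsFreePair x.1 y.1
      · obtain ⟨σ, hσ, rfl⟩ := exists_stabilizer_smul_eq_multi p y x0 x h0.1 h0.2 hx.1 hx.2
        have h1 := multiSpechtEntry_smul σ y x0
        rw [hσ] at h1
        have h2 := monomialRep_apply p ⟨1, σ⟩ u x0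
        rw [hu ⟨⟨1, σ⟩, hσ⟩, Finsupp.smul_apply, smul_eq_mul] at h2
        change signHom n σ * weight 1 y.1 * u (σ • x0) = weight 1 (σ • x0).1 * u x0 at h2
        rw [weight_one, weight_one, mul_one, one_mul] at h2
        rw [h1, ← h2]
        field_simp
        linear_combination (-u (σ • x0)) * signHom_mul_self σ
      · rw [hzero x hx, of_not_not (mt (multiSpechtEntry_ne_zero_iff _ _).1 hx), mul_zero]
    · push Not at hex
      refine ⟨0, Finsupp.ext fun x => ?_⟩
      rw [hzero x fun h => hex x h.1 h.2]
      simp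
  · have hg : g.1.right • y = y := g.2
    rw [← Equiv.sum_comp (MulAction.toPerm g.1.right), Finset.mul_sum]
    refine Finset.sum_congr rfl fun x _ => ?_
    rw [MulAction.toPerm_apply, monomialRep_apply, multiSpechtVector_apply, multiSpechtVector_apply]
    have h1 := multiSpechtEntry_smul g.1.right y x
    rw [hg] at h1
    change _ = signHom n g.1.right * weight g.1.left y.1 * _
    by_cases h0 : multiSpechtEntry y.1 (g.1.right • x).1 = 0
    · rw [h0] at h1
      linear_combination (weight g.1.left (g.1.right • x).1 * u x) * h0
        + (weight g.1.left y.1 * u x) * h1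
    · rw [weight_eq_of_phase ((multiSpechtEntry_ne_zero_iff _ _).1 h0).1, h1]
      ring

/-- An isomorphism maps `v_y` to a nonzero vector that transforms in the same way under the
stabilizer of `y`, so that there is a free pair and `p` dominates `q`. -/
theorem card_cells_le_of_equiv [NeZero r] (p q : MultiPartition r n)
    (e : (multiSpechtRep p).Equiv (multiSpechtRep q)) (k : Fin r) (j : ℕ) :
    #{c ∈ (q.part k).cells | c.1 < j} ≤ #{c ∈ (p.part k).cells | c.1 < j} := by
  obtain ⟨x0, y0, hx0, hy0, -, -, h⟩ := exists_isFreePair_multi p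
  let y : MX p.transpose := ⟨_, hy0⟩
  let v : MultiSpace p := ⟨multiSpechtVector p y, Submodule.subset_span ⟨y, rfl⟩⟩
  have hv : ∀ g : multiStabilizer y,
      multiSpechtRep p g v = multiStabilizerChar y g • v := fun g => by
    refine Subtype.ext ?_
    have h1 := monomialRep_multiSpechtVector p g.1 y
    have hg : g.1.right • y = y := g.2
    rw [hg] at h1
    exact h1
  have hv0 : v ≠ 0 := fun h0 => multiSpechtVector_ne_zero p ⟨_, hx0⟩ y
    ⟨fun _ => rfl, (isFreePair_assemble _ _ _).2 h⟩ (congrArg Subtype.val h0)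
  let w : MX q →₀ ℂ := (e v).1
  have hw : ∀ g : multiStabilizer y, monomialRep q g w = multiStabilizerChar y g • w :=
    fun g => by
      have h1 : e (multiSpechtRep p g v) = multiSpechtRep q g (e v) :=
        Representation.IntertwiningMap.isIntertwining _ _ e.toIntertwiningMap g.1 v
      rw [hv, map_smul] at h1
      exact (congrArg Subtype.val h1).symm
  have hw0 : w ≠ 0 := fun h0 => by
    refine hv0 ?_
    have h1 : e v = 0 := Subtype.ext h0
    have h2 := e.symm_apply_apply v
    rw [h1] at h2
    exact h2.symm.trans (map_zero e.symm)
  obtain ⟨x, hx⟩ : ∃ x, w x ≠ 0 := by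
    by_contra! hall
    exact hw0 (Finsupp.ext hall)
  have := of_not_not (mt (apply_eq_zero_of_not_isFreePair q y w hw x) hx)
  exact card_cells_le_of_isFreePair p q x y this.1 this.2 k j

theorem eq_of_equiv [NeZero r] (p q : MultiPartition r n)
    (e : (multiSpechtRep p).Equiv (multiSpechtRep q)) : p = q :=
  MultiPartition.ext (funext fun k => (eq_of_card_cells_eq fun j =>
    le_antisymm (card_cells_le_of_equiv p q e k j) (card_cells_le_of_equiv q p e.symm k j)).symm)

end MultiIrreducible

/-! ### The characters -/

instance (n : ℕ) (μ : YoungDiagram) : FiniteDimensional ℂ (SymmetricSpace n μ) :=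
  inferInstanceAs (FiniteDimensional ℂ (symmetricSpecht n μ).toSubmodule)

instance {r n : ℕ} (p : MultiPartition r n) : FiniteDimensional ℂ (MultiSpace p) :=
  inferInstanceAs (FiniteDimensional ℂ (multiSpecht p).toSubmodule)

/-- The coefficient of `x` in `σ • v_y`. -/
def spechtCoeff {n : ℕ} (y x : Fin n → Fin n) (σ : Perm (Fin n)) : ℂ :=
  signHom n σ * spechtEntry (fun i => y (σ⁻¹ i)) x

theorem symmetricChar_eq (μ : YoungDiagram) (x : X μ.card μ) (y : X μ.card μ.transpose)
    (h : IsFreePair x.1 y.1) : symmetricChar μ = coeffChar (spechtCoeff y.1 x.1) := by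
  have := symmetricSpechtRep_isIrreducible (μ := μ) rfl
  let v : SymmetricSpace μ.card μ := ⟨spechtVector _ μ y, Submodule.subset_span ⟨y, rfl⟩⟩
  let l : SymmetricSpace μ.card μ →ₗ[ℂ] ℂ :=
    Finsupp.lapply x ∘ₗ (symmetricSpecht μ.card μ).toSubmodule.subtype
  have hv : ∀ σ, l (symmetricSpechtRep μ.card μ σ v) = spechtCoeff y.1 x.1 σ := fun σ => by
    change symmetricRep μ.card μ σ (spechtVector _ μ y) x = _
    rw [symmetricRep_spechtVector, Finsupp.smul_apply, spechtVector_apply]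
    rfl
  have hl : l v ≠ 0 := by
    change spechtVector _ μ y x ≠ 0
    rw [spechtVector_apply]
    exact (spechtEntry_ne_zero_iff _ _).2 h
  rw [symmetricChar, character_eq_coeffChar _ v l hl]
  exact congrArg coeffChar (funext hv)

section MultiCharacter

variable {r n : ℕ}

/-- The coefficient of `x` in `g • v_y`. -/
def multiSpechtCoeff (y x : Fin n → Fin n × Fin r) (g : MonomialGroup r n) : ℂ :=
  signHom n g.right * weight g.left (fun i => y (g.right⁻¹ i)) *
    multiSpechtEntry (fun i => y (g.right⁻¹ i)) x

theorem multiSpechtRep_character_eq [NeZero r] (p : MultiPartition r n) (x : MX p)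
    (y : MX p.transpose) (h : (∀ i, (x.1 i).2 = (y.1 i).2) ∧ IsFreePair x.1 y.1) :
    (multiSpechtRep p).character = coeffChar (multiSpechtCoeff y.1 x.1) := by
  have := multiSpechtRep_isIrreducible p
  let v : MultiSpace p := ⟨multiSpechtVector p y, Submodule.subset_span ⟨y, rfl⟩⟩
  let l : MultiSpace p →ₗ[ℂ] ℂ := Finsupp.lapply x ∘ₗ (multiSpecht p).toSubmodule.subtype
  have hv : ∀ g, l (multiSpechtRep p g v) = multiSpechtCoeff y.1 x.1 g := fun g => by
    change monomialRep p g (multiSpechtVector p y) x = _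
    rw [monomialRep_multiSpechtVector, Finsupp.smul_apply, multiSpechtVector_apply]
    rfl
  have hl : l v ≠ 0 := by
    change multiSpechtVector p y x ≠ 0
    rw [multiSpechtVector_apply]
    exact (multiSpechtEntry_ne_zero_iff _ _).2 h
  rw [character_eq_coeffChar _ v l hl]
  exact congrArg coeffChar (funext hv)

/-- The linear character `linearChar k` as a homomorphism. -/
def linearCharHom (k : Fin r) : MonomialGroup r n →* ℂ where
  toFun := linearChar k
  map_one' := by simp [linearChar]
  map_mul' g h := by
    have h1 : ∏ i, ((h.left (g.right⁻¹ i) : ℂˣ) : ℂ) ^ (k : ℕ) =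
        ∏ i, ((h.left i : ℂˣ) : ℂ) ^ (k : ℕ) :=
      Equiv.prod_comp (g.right⁻¹ : Perm (Fin n)) fun i => ((h.left i : ℂˣ) : ℂ) ^ (k : ℕ)
    rw [linearChar, linearChar, linearChar, ← h1, ← Finset.prod_mul_distrib]
    refine Finset.prod_congr rfl fun i _ => ?_
    change (((g.left i * h.left (g.right⁻¹ i) : rootsOfUnity r ℂ) : ℂˣ) : ℂ) ^ (k : ℕ) = _
    rw [Subgroup.coe_mul, Units.val_mul, mul_pow]

theorem sum_rightHom [NeZero r] (φ : Perm (Fin n) → ℂ) :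
    ∑ g : MonomialGroup r n, φ (SemidirectProduct.rightHom g) =
      (Nat.card (Fin n → rootsOfUnity r ℂ) : ℂ) * ∑ σ, φ σ := by
  have := Fintype.ofFinite (Fin n → rootsOfUnity r ℂ)
  rw [← Equiv.sum_comp SemidirectProduct.equivProd.symm, Fintype.sum_prod_type]
  simp only [SemidirectProduct.rightHom_eq_right]
  change ∑ _α : Fin n → rootsOfUnity r ℂ, ∑ σ, φ σ = _
  rw [Finset.sum_const, Finset.card_univ, nsmul_eq_mul, Nat.card_eq_fintype_card]

variable {m : Fin r → ℕ} (h : ∑ k, m k = n)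

theorem blockEmbedding_left (g : ∀ k, MonomialGroup r (m k)) (k : Fin r) (j : Fin (m k)) :
    (blockEmbedding m h g).left (blocks m h ⟨k, j⟩) = (g k).left j :=
  congrArg (fun s : (k : Fin r) × Fin (m k) => (g s.1).left s.2)
    (symm_apply_apply (blocks m h) ⟨k, j⟩)

theorem blockEmbedding_right (g : ∀ k, MonomialGroup r (m k)) (k : Fin r) (j : Fin (m k)) :
    (blockEmbedding m h g).right (blocks m h ⟨k, j⟩) = blocks m h ⟨k, (g k).right j⟩ :=
  congrArg (fun s : (k : Fin r) × Fin (m k) => blocks m h ⟨s.1, (g s.1).right s.2⟩)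
    (symm_apply_apply (blocks m h) ⟨k, j⟩)

theorem blockEmbedding_injective : Function.Injective (blockEmbedding (r := r) m h) := by
  intro g g' hg
  refine funext fun k => SemidirectProduct.ext (funext fun j => ?_) (Equiv.ext fun j => ?_)
  · rw [← blockEmbedding_left h, hg, blockEmbedding_left]
  · have := blockEmbedding_right h g k j
    rw [hg, blockEmbedding_right] at this
    simpa using this.symm

/-- The block diagonal subgroup consists of the elements that preserve the blocks. -/
theorem mem_range_blockEmbedding (g : MonomialGroup r n)
    (hg : ∀ i, ((blocks m h).symm (g.right i)).1 = ((blocks m h).symm i).1) :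
    g ∈ Set.range (blockEmbedding m h) := by
  let e := blocks m h
  have hs : ∀ k (j : Fin (m k)), (e.symm (g.right (e ⟨k, j⟩))).1 = k := fun k j => by
    rw [hg, symm_apply_apply]
  have hs' : ∀ k (j : Fin (m k)), (e.symm (g.right⁻¹ (e ⟨k, j⟩))).1 = k := fun k j => by
    have := hg (g.right⁻¹ (e ⟨k, j⟩))
    rw [Perm.coe_inv, apply_symm_apply, symm_apply_apply] at this
    exact this.symm
  have hcast : ∀ (k : Fin r) (s : (k : Fin r) × Fin (m k)) (hk : s.1 = k),
      (⟨k, Fin.cast (congrArg m hk) s.2⟩ : (k : Fin r) × Fin (m k)) = s := by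
    rintro k ⟨k, j⟩ rfl
    rfl
  let τ : ∀ k, Perm (Fin (m k)) := fun k =>
    { toFun := fun j => Fin.cast (congrArg m (hs k j)) (e.symm (g.right (e ⟨k, j⟩))).2
      invFun := fun j => Fin.cast (congrArg m (hs' k j)) (e.symm (g.right⁻¹ (e ⟨k, j⟩))).2
      left_inv := fun j => by
        apply sigma_mk_injective (i := k)
        refine (hcast k _ (hs' k _)).trans ?_
        rw [hcast k _ (hs k j), apply_symm_apply, Perm.coe_inv, symm_apply_apply, symm_apply_apply]
      right_inv := fun j => by
        apply sigma_mk_injective (i := k)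
        refine (hcast k _ (hs k _)).trans ?_
        rw [hcast k _ (hs' k j), apply_symm_apply, Perm.coe_inv, apply_symm_apply,
          symm_apply_apply] }
  refine ⟨fun k => ⟨fun j => g.left (e ⟨k, j⟩), τ k⟩, SemidirectProduct.ext (funext ?_)
    (Equiv.ext ?_)⟩
  · exact forall_blocks h fun k j => blockEmbedding_left h _ k j
  · refine forall_blocks h fun k j => ?_
    rw [blockEmbedding_right]
    exact (congrArg e (hcast k _ (hs k j))).trans (apply_symm_apply e _)

theorem assemble_comp_inv (y : ∀ k, Fin (m k) → Fin (m k)) (g : ∀ k, MonomialGroup r (m k)) :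
    (fun i => assemble h y ((blockEmbedding m h g).right⁻¹ i)) =
      assemble h fun k j => y k ((g k).right⁻¹ j) := by
  refine funext (forall_blocks h fun k j => ?_)
  have : (blockEmbedding m h g).right⁻¹ (blocks m h ⟨k, j⟩) =
      blocks m h ⟨k, (g k).right⁻¹ j⟩ := by
    rw [Perm.inv_eq_iff_eq, blockEmbedding_right, Perm.coe_inv, apply_symm_apply]
  rw [this, assemble_blocks, assemble_blocks]

theorem weight_assemble (y : ∀ k, Fin (m k) → Fin (m k)) (g : ∀ k, MonomialGroup r (m k)) :
    weight (blockEmbedding m h g).left (assemble h y) = ∏ k, linearChar k (g k) := by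
  rw [weight, ← Equiv.prod_comp (blocks m h), Fintype.prod_sigma]
  refine Finset.prod_congr rfl fun k _ => Finset.prod_congr rfl fun j _ => ?_
  rw [blockEmbedding_left, assemble_blocks]

theorem signHom_blockEmbedding (g : ∀ k, MonomialGroup r (m k)) :
    signHom n (blockEmbedding m h g).right = ∏ k, signHom (m k) (g k).right := by
  have : (blockEmbedding m h g).right =
      (blocks m h).permCongr (Perm.sigmaCongrRight fun k => (g k).right) := rfl
  rw [this, signHom_apply, Perm.sign_permCongr, sign_sigmaCongrRight]
  push_cast
  rfl

/-- On the block diagonal subgroup, the coefficients of the monomial group are products of twisted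
coefficients of symmetric groups. -/
theorem multiSpechtCoeff_blockEmbedding (y x : ∀ k, Fin (m k) → Fin (m k))
    (g : ∀ k, MonomialGroup r (m k)) :
    multiSpechtCoeff (assemble h y) (assemble h x) (blockEmbedding m h g) =
      ∏ k, linearChar k (g k) * spechtCoeff (y k) (x k) (g k).right := by
  unfold multiSpechtCoeff spechtCoeff
  rw [assemble_comp_inv, weight_assemble, signHom_blockEmbedding, multiSpechtEntry_assemble]
  simp only [Finset.prod_mul_distrib]
  ring

/-- The coefficients for words assembled along the blocks vanish outside the block diagonal
subgroup, because only its elements preserve the phases. -/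
theorem mem_range_of_multiSpechtCoeff_ne_zero (y x : ∀ k, Fin (m k) → Fin (m k))
    (g : MonomialGroup r n) (hg : multiSpechtCoeff (assemble h y) (assemble h x) g ≠ 0) :
    g ∈ Set.range (blockEmbedding m h) := by
  refine mem_range_blockEmbedding h g fun i => ?_
  have h1 := ((multiSpechtEntry_ne_zero_iff _ _).1 (right_ne_zero_of_mul hg)).1 (g.right i)
  rw [Perm.coe_inv, symm_apply_apply] at h1
  exact h1

theorem multiSpechtRep_character [NeZero r] (p : MultiPartition r n) :
    (multiSpechtRep p).character = cliffordChar p := by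
  obtain ⟨x, y, hx, hy, hx', hy', hf⟩ := exists_isFreePair_multi p
  rw [multiSpechtRep_character_eq p ⟨_, hx⟩ ⟨_, hy⟩
    ⟨fun _ => rfl, (isFreePair_assemble _ _ _).2 hf⟩,
    coeffChar_eq_inducedChar _ (blockEmbedding_injective p.sum_card) _
      (mem_range_of_multiSpechtCoeff_ne_zero p.sum_card y x), cliffordChar]
  refine congrArg (inducedChar _) (funext fun g => ?_)
  have h1 : multiSpechtCoeff (assemble p.sum_card y) (assemble p.sum_card x) ∘
      blockEmbedding (fun k => (p.part k).card) p.sum_card =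
      fun g => ∏ k, linearCharHom k (g k) *
        spechtCoeff (y k) (x k) (SemidirectProduct.rightHom (g k)) :=
    funext fun g => multiSpechtCoeff_blockEmbedding p.sum_card y x g
  have h2 := coeffChar_pi (fun (k : Fin r) (g : MonomialGroup r (p.part k).card) =>
    linearCharHom k g * spechtCoeff (y k) (x k) (SemidirectProduct.rightHom g)) g
  refine (congrFun (congrArg coeffChar h1) g).trans (h2.trans ?_)
  refine Finset.prod_congr rfl fun k _ => ?_
  rw [symmetricChar_eq (p.part k) ⟨x k, hx' k⟩ ⟨y k, hy' k⟩ (hf k)]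
  exact coeffChar_mul_inflation _ _ (Nat.cast_ne_zero.2 Nat.card_pos.ne') sum_rightHom _ _ _

end MultiCharacter

/-! ### Conjugacy classes of the monomial group -/

section CycleProducts

variable {ι A : Type*} [CommGroup A]

/-- The product of the values of `α` over the cycle of `π` through `i`. -/
def cycleProd (α : ι → A) (π : Perm ι) (i : ι) : A :=
  ∏ j ∈ Finset.range (Function.minimalPeriod π i), α (π^[j] i)

theorem cycleProd_semiconj {α α' : ι → A} {π π' : Perm ι} (σ : Perm ι)
    (hσ : ∀ i, σ (π i) = π' (σ i)) (hα : ∀ i, α' (σ i) = α i) (i : ι) :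
    cycleProd α' π' (σ i) = cycleProd α π i := by
  have hit : ∀ j, π'^[j] (σ i) = σ (π^[j] i) := fun j =>
    ((Function.Semiconj.iterate_right (f := σ) hσ j) i).symm
  have hper : Function.minimalPeriod π' (σ i) = Function.minimalPeriod π i := by
    rw [Function.minimalPeriod_eq_minimalPeriod_iff]
    intro j
    rw [Function.IsPeriodicPt, Function.IsFixedPt, hit, σ.injective.eq_iff]
    rfl
  rw [cycleProd, hper]
  exact Finset.prod_congr rfl fun j _ => by rw [hit, hα]

variable [Finite ι]

theorem cycleProd_apply (α : ι → A) (π : Perm ι) (i : ι) :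
    cycleProd α π (π i) = cycleProd α π i := by
  have hper : Function.minimalPeriod π (π i) = Function.minimalPeriod π i :=
    Function.minimalPeriod_apply (Function.Injective.mem_periodicPts π.injective i)
  have h1 := Finset.prod_range_succ (fun j => α (π^[j] i)) (Function.minimalPeriod π i)
  rw [Finset.prod_range_succ', Function.iterate_minimalPeriod] at h1
  rw [cycleProd, hper, cycleProd]
  exact mul_right_cancel h1

/-- A function whose cycle products are all trivial is a coboundary. -/
theorem exists_eq_mul_of_cycleProd_eq_one (γ : ι → A) (π : Perm ι)
    (h : ∀ i, cycleProd γ π i = 1) : ∃ β : ι → A, ∀ i, β (π i) = β i * γ i := by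
  let f : ι → ℕ → A := fun q m => ∏ j ∈ Finset.range m, γ (π^[j] q)
  have hadd : ∀ q a d, f q (a + d) = f q a * f (π^[a] q) d := fun q a d => by
    simp only [f, Finset.prod_range_add]
    congr 1
    refine Finset.prod_congr rfl fun j _ => ?_
    rw [add_comm, Function.iterate_add_apply]
  have hone : ∀ q d, π^[d] q = q → f q d = 1 := fun q d hd => by
    obtain ⟨e, rfl⟩ := Function.IsPeriodicPt.minimalPeriod_dvd (f := π) (x := q) hd
    clear hd
    induction e with
    | zero => simp [f]
    | succ e ih =>
      rw [mul_add, mul_one, add_comm, hadd, Function.iterate_minimalPeriod, ih, mul_one]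
      exact h q
  have hle : ∀ q a b, a ≤ b → π^[a] q = π^[b] q → f q a = f q b := fun q a b hab he => by
    obtain ⟨d, rfl⟩ := Nat.exists_eq_add_of_le hab
    rw [add_comm, Function.iterate_add_apply] at he
    rw [hadd, hone _ _ he.symm, mul_one]
  have hwd : ∀ q a b, π^[a] q = π^[b] q → f q a = f q b := fun q a b he => by
    rcases le_total a b with hab | hab
    · exact hle q a b hab he
    · exact (hle q b a hab he.symm).symm
  -- Sum up `γ` along each cycle, starting from a chosen representative.
  let q : ι → ι := fun i => (Quotient.mk (Perm.SameCycle.setoid π) i).out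
  have hq : ∀ i, π.SameCycle (q i) i := fun i => Quotient.mk_out (s := Perm.SameCycle.setoid π) i
  have hqπ : ∀ i, q (π i) = q i := fun i =>
    congrArg Quotient.out (Quotient.sound (s := Perm.SameCycle.setoid π)
      (show π.SameCycle (π i) i from (Perm.SameCycle.refl π i).apply_left))
  choose m hm using fun i => (hq i).exists_nat_pow_eq
  have hm' : ∀ i, π^[m i] (q i) = i := fun i => by rw [Perm.iterate_eq_pow, hm]
  refine ⟨fun i => f (q i) (m i), fun i => ?_⟩
  have h1 : f (q i) (m (π i)) = f (q i) (m i + 1) := by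
    apply hwd
    rw [Function.iterate_succ_apply', hm', ← hqπ, hm']
  have h2 : f (q i) 1 = γ (q i) := by simp [f]
  change f (q (π i)) (m (π i)) = f (q i) (m i) * γ i
  rw [hqπ, h1, hadd, hm']
  simp [f]

end CycleProducts

section Partitions

/-- The Young diagram whose row lengths are the elements of a multiset. -/
def diagramOfParts (s : Multiset ℕ) : YoungDiagram :=
  YoungDiagram.ofRowLens (s.sort (· ≥ ·)) (Multiset.pairwise_sort s _).sortedGE

theorem rowLens_diagramOfParts {s : Multiset ℕ} (hs : ∀ x ∈ s, 0 < x) :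
    (diagramOfParts s).rowLens = s.sort (· ≥ ·) :=
  YoungDiagram.rowLens_ofRowLens_eq_self fun x hx => hs x ((Multiset.mem_sort _).1 hx)

theorem diagramOfParts_injOn {s t : Multiset ℕ} (hs : ∀ x ∈ s, 0 < x) (ht : ∀ x ∈ t, 0 < x)
    (h : diagramOfParts s = diagramOfParts t) : s = t := by
  rw [← Multiset.sort_eq s (· ≥ ·), ← Multiset.sort_eq t (· ≥ ·), ← rowLens_diagramOfParts hs,
    ← rowLens_diagramOfParts ht, h]

theorem card_eq_sum_rowLens (μ : YoungDiagram) : μ.card = μ.rowLens.sum := by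
  rw [YoungDiagram.card, Finset.card_eq_sum_card_fiberwise (f := Prod.fst)
    (t := Finset.range (μ.colLen 0))]
  · change _ = ∑ i ∈ Finset.range (μ.colLen 0), μ.rowLen i
    refine Finset.sum_congr rfl fun i _ => ?_
    rw [YoungDiagram.rowLen_eq_card]
    rfl
  · rintro ⟨i, j⟩ hc
    rw [Finset.mem_coe, Finset.mem_range, ← YoungDiagram.mem_iff_lt_colLen]
    exact μ.up_left_mem le_rfl (Nat.zero_le _) hc

theorem card_diagramOfParts {s : Multiset ℕ} (hs : ∀ x ∈ s, 0 < x) :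
    (diagramOfParts s).card = s.sum := by
  rw [card_eq_sum_rowLens, rowLens_diagramOfParts hs, ← Multiset.sum_coe, Multiset.sort_eq]

/-- Permutations of two finite sets with the same cycle lengths correspond to each other under a
bijection between these sets. -/
theorem exists_equiv_of_parts_eq {ι κ : Type*} [Fintype ι] [DecidableEq ι] [Fintype κ]
    [DecidableEq κ] (σ : Perm ι) (τ : Perm κ) (h : σ.partition.parts = τ.partition.parts) :
    ∃ e : ι ≃ κ, ∀ i, e (σ i) = τ (e i) := by
  have hcard : Fintype.card ι = Fintype.card κ := by
    rw [← σ.partition.parts_sum, h, τ.partition.parts_sum]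
  let e₀ : ι ≃ κ := Fintype.equivOfCardEq hcard
  let f : ι ≃ Subtype fun _ : κ => True := e₀.trans (Equiv.subtypeUnivEquiv fun _ => trivial).symm
  have hf : σ.extendDomain f = e₀.permCongr σ := by
    ext k
    obtain ⟨i, rfl⟩ := e₀.surjective k
    have := Perm.extendDomain_apply_image σ f i
    rw [permCongr_apply, symm_apply_apply]
    exact this
  have hc : (e₀.permCongr σ).cycleType = τ.cycleType := by
    rw [← hf, Perm.cycleType_extendDomain, ← Perm.filter_parts_partition_eq_cycleType, h,
      Perm.filter_parts_partition_eq_cycleType]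
  obtain ⟨c, hc⟩ := isConj_iff.1 (Perm.isConj_of_cycleType_eq hc)
  refine ⟨e₀.trans c, fun i => ?_⟩
  rw [← hc]
  simp [permCongr_apply]

end Partitions

section Classes

variable {r n : ℕ} [NeZero r]

/-- A numbering of the `r`-th roots of unity. -/
def rootEquiv (r : ℕ) [NeZero r] : rootsOfUnity r ℂ ≃ Fin r :=
  Finite.equivFinOfCardEq (Complex.card_rootsOfUnity r)

/-- The permutation induced by a monomial matrix on the union of its cycles with product `a`. -/
def cyclePerm (g : MonomialGroup r n) (a : rootsOfUnity r ℂ) :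
    Perm {i // cycleProd g.left g.right i = a} :=
  g.right.subtypePerm fun i => by rw [cycleProd_apply]

open Classical in
/-- The multipartition formed, for each root of unity, by the lengths of the cycles with that
product. -/
def classData (g : MonomialGroup r n) : MultiPartition r n where
  part k := diagramOfParts (cyclePerm g ((rootEquiv r).symm k)).partition.parts
  sum_card := by
    simp_rw [card_diagramOfParts fun x hx => Nat.Partition.parts_pos _ hx,
      Nat.Partition.parts_sum]
    rw [← Fintype.card_sigma]
    refine (Fintype.card_congr ?_).trans (Fintype.card_fin n)
    refine Equiv.trans ?_ (Equiv.sigmaFiberEquiv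
      fun i => rootEquiv r (cycleProd g.left g.right i))
    exact Equiv.sigmaCongrRight fun k => Equiv.subtypeEquivRight fun i => by
      rw [Equiv.eq_symm_apply]

/-- First match the cycles of equal length and product by conjugating with a permutation; the
remaining discrepancy has trivial cycle products and is removed by a diagonal matrix. -/
theorem isConj_of_classData_eq {g g' : MonomialGroup r n} (h : classData g = classData g') :
    IsConj g g' := by
  classical
  have he : ∀ a, ∃ e : {i // cycleProd g.left g.right i = a} ≃
      {i // cycleProd g'.left g'.right i = a},
      ∀ i, e (cyclePerm g a i) = cyclePerm g' a (e i) := fun a => by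
    apply exists_equiv_of_parts_eq
    have h1 := congrFun (congrArg MultiPartition.part h) (rootEquiv r a)
    have h2 := diagramOfParts_injOn (fun x hx => Nat.Partition.parts_pos _ hx)
      (fun x hx => Nat.Partition.parts_pos _ hx) h1
    rw [symm_apply_apply] at h2
    convert h2
  choose e he using he
  let σ : Perm (Fin n) := Equiv.ofFiberEquiv e
  have hσa : ∀ a i (hi : cycleProd g.left g.right i = a), σ i = (e a ⟨i, hi⟩).1 := by
    rintro _ i rfl
    rfl
  have hσc : ∀ i, cycleProd g'.left g'.right (σ i) = cycleProd g.left g.right i := fun i => by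
    rw [hσa _ i rfl]
    exact (e _ _).2
  have hσπ : ∀ i, σ (g.right i) = g'.right (σ i) := fun i => by
    rw [hσa _ i rfl, hσa _ (g.right i) (cycleProd_apply _ _ i)]
    exact congrArg Subtype.val (he _ ⟨i, rfl⟩)
  let α : Fin n → rootsOfUnity r ℂ := fun i => g.left (σ⁻¹ i)
  have hα : ∀ i, cycleProd α g'.right i = cycleProd g'.left g'.right i := fun i => by
    obtain ⟨i, rfl⟩ := σ.surjective i
    rw [hσc, cycleProd_semiconj σ hσπ]
    intro i
    simp [α]
  obtain ⟨β, hβ⟩ := exists_eq_mul_of_cycleProd_eq_one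
    (fun i => g'.left (g'.right i) / α (g'.right i)) g'.right fun i => by
      have h1 := hα (g'.right i)
      have hper : Function.minimalPeriod g'.right (g'.right i) =
          Function.minimalPeriod g'.right i :=
        Function.minimalPeriod_apply (Function.Injective.mem_periodicPts g'.right.injective i)
      rw [cycleProd, cycleProd, hper] at h1
      rw [cycleProd, Finset.prod_div_distrib, div_eq_one]
      simp only [← Function.iterate_succ_apply' g'.right, Function.iterate_succ_apply]
      exact h1.symm
  refine isConj_iff.2 ⟨⟨β, σ⟩, ?_⟩
  rw [mul_inv_eq_iff_eq_mul]
  refine SemidirectProduct.ext (funext fun i => ?_) (Equiv.ext hσπ)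
  change β i * α i = g'.left i * β (g'.right⁻¹ i)
  obtain ⟨i, rfl⟩ := g'.right.surjective i
  rw [hβ, Perm.coe_inv, symm_apply_apply, mul_assoc, div_mul_cancel, mul_comm]

/-- There are at most as many conjugacy classes as multipartitions. -/
theorem exists_injective_conjClasses :
    ∃ f : ConjClasses (MonomialGroup r n) → MultiPartition r n, Function.Injective f := by
  refine ⟨fun c => classData c.out, fun c c' hc => ?_⟩
  have h1 := ConjClasses.mk_eq_mk_iff_isConj.2 (isConj_of_classData_eq hc)
  have h2 : ∀ c : ConjClasses (MonomialGroup r n), ConjClasses.mk c.out = c := Quotient.out_eq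
  rwa [h2, h2] at h1

end Classes

/-! ### Completeness -/

section Completeness

variable {G : Type*} [Group G]

theorem finiteDimensional_of_isIrreducible [Finite G] {V : Type*} [AddCommGroup V] [Module ℂ V]
    (ρ : Representation ℂ G V) [hρ : ρ.IsIrreducible] : FiniteDimensional ℂ V := by
  have hnt : ∃ v : V, v ≠ 0 := by
    by_contra! h
    refine (bot_ne_top (α := Subrepresentation ρ)) (Subrepresentation.toSubmodule_injective ?_)
    ext v
    simp [h v]
  obtain ⟨v, hv⟩ := hnt
  let U : Subrepresentation ρ :=
    { toSubmodule := Submodule.span ℂ (Set.range fun g => ρ g v)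
      apply_mem_toSubmodule := fun g u hu => by
        induction hu using Submodule.span_induction with
        | mem u hu =>
          obtain ⟨h, rfl⟩ := hu
          exact Submodule.subset_span ⟨g * h, by simp⟩
        | zero => simp
        | add a b _ _ ha hb => rw [map_add]; exact add_mem ha hb
        | smul c a _ ha => rw [map_smul]; exact Submodule.smul_mem _ _ ha }
  have hvU : v ∈ U.toSubmodule := Submodule.subset_span ⟨1, by simp⟩
  have hU : U = ⊤ := (eq_bot_or_eq_top U).resolve_left fun h => by
    rw [h] at hvU
    exact hv ((Submodule.mem_bot ℂ).1 hvU)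
  have htop : Submodule.span ℂ (Set.range fun g => ρ g v) = ⊤ :=
    congrArg Subrepresentation.toSubmodule hU
  exact ⟨htop ▸ Submodule.fg_span (Set.finite_range _)⟩

/-- Class functions that are orthonormal for the pairing `∑ φ(g) ψ(g⁻¹)`, viewed as functions on
conjugacy classes, are linearly independent. -/
theorem linearIndependent_of_orthonormal [Fintype G] {ι : Type*} (φ : ι → ConjClasses G → ℂ)
    (c : ℂ) (hon : ∀ i, c * ∑ g : G, φ i (ConjClasses.mk g) * φ i (ConjClasses.mk g⁻¹) = 1)
    (horth : ∀ i j, i ≠ j → c * ∑ g : G, φ i (ConjClasses.mk g) * φ j (ConjClasses.mk g⁻¹) = 0) :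
    LinearIndependent ℂ φ := by
  classical
  rw [linearIndependent_iff']
  intro s a ha j hj
  have h1 : ∀ g : G, ∑ i ∈ s, a i * φ i (ConjClasses.mk g) = 0 := fun g => by
    simpa using congrFun ha (ConjClasses.mk g)
  have h2 :
      ∑ i ∈ s, a i * (c * ∑ g : G, φ i (ConjClasses.mk g) * φ j (ConjClasses.mk g⁻¹)) = 0 := by
    calc _ = c * ∑ g : G, (∑ i ∈ s, a i * φ i (ConjClasses.mk g)) * φ j (ConjClasses.mk g⁻¹) := by
          simp only [Finset.mul_sum, Finset.sum_mul]
          rw [Finset.sum_comm]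
          exact Finset.sum_congr rfl fun g _ => Finset.sum_congr rfl fun i _ => by ring
      _ = 0 := by simp [h1]
  rw [Finset.sum_eq_single_of_mem j hj fun i _ hij => by rw [horth i j hij, mul_zero], hon,
    mul_one] at h2
  exact h2

/-- The character of a representation as a function on conjugacy classes. -/
def classChar {V : Type*} [AddCommGroup V] [Module ℂ V] (ρ : Representation ℂ G V) :
    ConjClasses G → ℂ :=
  Quotient.lift ρ.character fun g h hgh => by
    obtain ⟨c, rfl⟩ := isConj_iff.1 hgh
    rw [ρ.char_conj]

end Completeness

/-- An irreducible representation isomorphic to none of the `S^λ` would, together with these, give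
more independent class functions than there are conjugacy classes. -/
theorem exists_equiv_of_isIrreducible {r n : ℕ} [NeZero r] {V : Type*} [AddCommGroup V]
    [Module ℂ V] (ρ : Representation ℂ (MonomialGroup r n) V) (hρ : ρ.IsIrreducible) :
    ∃ p : MultiPartition r n, Nonempty (ρ.Equiv (multiSpechtRep p)) := by
  classical
  by_contra! hno
  have := finiteDimensional_of_isIrreducible ρ
  have hirr := multiSpechtRep_isIrreducible (r := r) (n := n)
  have : Invertible (Nat.card (MonomialGroup r n) : ℂ) :=
    invertibleOfNonzero (Nat.cast_ne_zero.2 Nat.card_pos.ne')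
  let φ : Option (MultiPartition r n) → ConjClasses (MonomialGroup r n) → ℂ :=
    fun o => o.elim (classChar ρ) fun p => classChar (multiSpechtRep p)
  have hlin : LinearIndependent ℂ φ := by
    refine linearIndependent_of_orthonormal φ (Nat.card (MonomialGroup r n) : ℂ)⁻¹ ?_ ?_
    · rintro (_ | p)
      · exact (Representation.char_orthonormal ρ ρ).trans (if_pos ⟨.refl _⟩)
      · exact (Representation.char_orthonormal (multiSpechtRep p) (multiSpechtRep p)).trans
          (if_pos ⟨.refl _⟩)
    · rintro (_ | p) (_ | q) hpq
      · exact absurd rfl hpq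
      · exact (Representation.char_orthonormal ρ (multiSpechtRep q)).trans
          (if_neg fun ⟨e⟩ => (hno q).false e.symm)
      · exact (Representation.char_orthonormal (multiSpechtRep p) ρ).trans
          (if_neg fun ⟨e⟩ => (hno p).false e)
      · exact (Representation.char_orthonormal (multiSpechtRep p) (multiSpechtRep q)).trans
          (if_neg fun ⟨e⟩ => hpq (congrArg some (eq_of_equiv q p e).symm))
  have := Fintype.ofFinite (ConjClasses (MonomialGroup r n))
  have := hlin.finite
  have : Finite (MultiPartition r n) := Finite.of_injective _ (Option.some_injective _)
  have := Fintype.ofFinite (MultiPartition r n)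
  obtain ⟨f, hf⟩ := exists_injective_conjClasses (r := r) (n := n)
  have h1 := hlin.fintype_card_le_finrank
  rw [Module.finrank_fintype_fun_eq_card, Fintype.card_option] at h1
  have h2 := Fintype.card_le_of_injective f hf
  omega

end MultiSpecht

end

theorem mainTheorem5 (r n : ℕ) [NeZero r] :
    (∀ p : MultiSpecht.MultiPartition r n,
      (MultiSpecht.multiSpechtRep p).character = MultiSpecht.cliffordChar p) ∧
    (∀ p : MultiSpecht.MultiPartition r n, (MultiSpecht.multiSpechtRep p).IsIrreducible) ∧
    (∀ p q : MultiSpecht.MultiPartition r n,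
      Nonempty ((MultiSpecht.multiSpechtRep p).Equiv (MultiSpecht.multiSpechtRep q)) → p = q) ∧
    (∀ (V : Type*) [AddCommGroup V] [Module ℂ V]
      (ρ : Representation ℂ (MultiSpecht.MonomialGroup r n) V), ρ.IsIrreducible →
        ∃ p : MultiSpecht.MultiPartition r n,
          Nonempty (ρ.Equiv (MultiSpecht.multiSpechtRep p))) :=
  ⟨MultiSpecht.multiSpechtRep_character, MultiSpecht.multiSpechtRep_isIrreducible,
    fun p q ⟨e⟩ => MultiSpecht.eq_of_equiv p q e,
    fun _ _ _ ρ hρ => MultiSpecht.exists_equiv_of_isIrreducible ρ hρ⟩
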